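/- **Setting.** Let $\mathcal F$ be a set of function symbols of bounded arity and $\mathcal X$ an infinite set of variables. $\mathcal T$ is the set of terms, and $\mathcal T_\square$ is the set of contexts (terms with exactly one occurrence of the hole $\square$). The depth $\delta(t)$ is $0$ for variables and constants. A term $u$ matches $t$ if some substitution instance of $u$ is $t$. Let $\cdot:\mathcal T_\square\times\mathcal T_\square\to\mathcal T_\square$ be any operation of merging of contexts; the standard one is $\tau\cdot\tau'=\tau[\tau']$. **Strategies.** CE-strategies are given (up to renaming of bound variables) by $$S ::= \emptyset \mid X \mid u;S \mid S\oplus S' \mid \mu X.S \mid \textstyle\bigwedge_{i\in I}@i.S_i\ [\wedge\, @\varepsilon.\tau] \mid \mathrm{Most}(S) \mid \mathrm{If}\ S\ \mathrm{Then}\ S',$$ where $X$ is a fixed-point variable, $u\in\mathcal T$, $\tau\in\mathcal T_\square$, $I$ is a finite set of child positions, and the final root insertion of a list is optional ($@\varepsilon.\tau$ alone is the case $I=\emptyset$). On $t\in\mathcal T$ a closed strategy yields a term or fails: * $\emptyset$ fails. $u;S$ acts as $S$ if $u$ matches $t$ and fails otherwise. $S\oplus S'$ acts as $S$ if $S$ does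 not fail on $t$ and as $S'$ otherwise. $\mathrm{If}\ S\ \mathrm{Then}\ S'$ acts as $S'$ if $S$ does not fail on $t$ and fails otherwise. * A list applies each $S_i$ to the $i$-th child of the root (if it exists), leaves unchanged the children at which this fails, and then, if $@\varepsilon.\tau$ is present, replaces the resulting term $t'$ by $\tau[t']$. It fails if all its members fail. $\mathrm{Most}(S)$ is the list that applies $S$ to all children of the root. * $\mu X.S(X)$ acts on $t$ as the iterate $S(S(\cdots S(\emptyset)))$ with $\delta(t)+1$ copies of $S$. Write $S\equiv S'$ if $S$ and $S'$ act in the same way on every term. Let $\mathcal C$ be the set of strategies that are closed and monotone, i.e. in each $\mu X.S(X)$ every occurrence of $X$ in $S(X)$ lies below a jump $@i$ to a child or below $\mathrm{Most}$. **Unification and combination.** $S\curlywedge S'$ is the normal form of $\langle S,S',\emptyset\rangle$ under the following rules, in decreasing order of priority, where $M$ is a memory of triples: 1. $\langle\emptyset,S,M\rangle\to\emptyset$; $\langle S,\emptyset,M\rangle\to\emptyset$. 2. $\langle @\varepsilon.\tau,@\varepsilon.\tau',M\rangle\to @\varepsilon.(\tau\cdot\tau')$. 3. $\langle u;S,S',M\rangle\to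 u;\langle S,S',M\rangle$; $\langle S',u;S,M\rangle\to u;\langle S',S,M\rangle$. 4. $\langle @i.S,@i.S',M\rangle\to @i.\langle S,S',M\rangle$. For other lists $S=\bigwedge_{i\in I}@i.S_i\,[\wedge @\varepsilon.\tau]$ and $S'=\bigwedge_{j\in J}@j.S'_j\,[\wedge @\varepsilon.\tau']$: $\langle S,S',M\rangle\to\mathrm{If}\ S\ \mathrm{Then}\ \mathrm{If}\ S'\ \mathrm{Then}\ L$, where $L$ is the list with member $\langle S_i,S'_i,M\rangle\oplus S_i\oplus S'_i$ at $i\in I\cap J$, member $S_i$ at $i\in I\setminus J$, member $S'_i$ at $i\in J\setminus I$, and root insertion $\tau\cdot\tau'$ (or the one of $\tau,\tau'$ that is present, if any). 5. $\langle S_1\oplus S_2,S,M\rangle\to\langle S_1,S,M\rangle\oplus\langle S_2,S,M\rangle$; $\langle S,S_1\oplus S_2,M\rangle\to\langle S,S_1,M\rangle\oplus\langle S,S_2,M\rangle$. 6. $\langle \mathrm{If}\,S_1\,\mathrm{Then}\,S_2,S,M\rangle\to\mathrm{If}\,S_1\,\mathrm{Then}\,\langle S_2,S,M\rangle$; $\langle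 S,\mathrm{If}\,S_1\,\mathrm{Then}\,S_2,M\rangle\to\mathrm{If}\,S_1\,\mathrm{Then}\,\langle S,S_2,M\rangle$. 7. $\langle\mathrm{Most}(S),\mathrm{Most}(S'),M\rangle\to\mathrm{If}\ \mathrm{Most}(S)\ \mathrm{Then}\ \mathrm{If}\ \mathrm{Most}(S')\ \mathrm{Then}\ \mathrm{Most}(\langle S,S',M\rangle\oplus S\oplus S')$. If only one component is $\mathrm{Most}(S)$ and the other is a list, $\mathrm{Most}(S)$ is replaced by the list of the $@i.S$ for all child positions $i$ up to the largest arity in $\mathcal F$. 8. With $\xi=\mu X.S(X)$: $\langle\xi,S',M\rangle\to Z$ if $(\xi,S',Z)\in M$, and otherwise $\langle\xi,S',M\rangle\to\mu Z.\langle S(\xi),S',M\cup\{(\xi,S',Z)\}\rangle$ with $Z$ fresh; then, symmetrically, for $\langle S',\xi,M\rangle$. The combination is $S\curlyvee S'=(S\curlywedge S')\oplus S\oplus S'$. **Theorem.** For every merging operation, the normal form above exists and is unique for all $S,S'\in\mathcal C$, and $S\curlyvee S'\in\mathcal C$. Moreover, up to semantic equivalence: 1. $\emptyset$ is neutral: for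 all $e,S\in\mathcal C$ with $e\equiv\emptyset$, $e\curlyvee S\equiv S$ and $S\curlyvee e\equiv S$. 2. $(S_1\curlyvee S_2)\curlyvee S_3\equiv S_1\curlyvee(S_2\curlyvee S_3)$ for all $S_1,S_2,S_3\in\mathcal C$ if and only if the merging of contexts is associative. In particular this holds for the standard merging $\tau\cdot\tau'=\tau[\tau']$. 3. $S\curlyvee S'\equiv S'\curlyvee S$ for all $S,S'\in\mathcal C$ if and only if $\tau\cdot\tau'=\tau'\cdot\tau$ for all $\tau,\tau'\in\mathcal T_\square$. 4. $S\curlyvee S\equiv S$ for all $S\in\mathcal C$ if and only if $\tau\cdot\tau=\tau$ for all $\tau\in\mathcal T_\square$. -/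

import Mathlib

namespace CES

/-- Terms over a signature `F` with arity function `ar` and over a set `X` of variables.
The children of a term with root `f` are numbered `0, …, ar f - 1`. -/
inductive Term {F : Type*} (ar : F → ℕ) (X : Type*) where
  | var (x : X) : Term ar X
  | app (f : F) (ts : Fin (ar f) → Term ar X) : Term ar X

/-- Terms with exactly one occurrence of the hole `□`: the hole itself, or a function symbol `f`
with a one-hole term at one child `i` and ordinary terms at the other children. -/
inductive Ctx {F : Type*} (ar : F → ℕ) (X : Type*) where
  | hole : Ctx ar X
  | app (f : F) (i : Fin (ar f)) (c : Ctx ar X) (ts : {j : Fin (ar f) // j ≠ i} → Term ar X) :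
      Ctx ar X

section Terms

variable {F : Type*} {ar : F → ℕ} {X : Type*}

/-- The depth of a term; variables and constants have depth `0`. -/
def Term.depth : Term ar X → ℕ
  | .var _ => 0
  | .app _ ts => Finset.univ.sup fun i => (ts i).depth + 1

/-- Application of a substitution to a term. -/
def Term.subst (σ : X → Term ar X) : Term ar X → Term ar X
  | .var x => σ x
  | .app f ts => .app f fun i => (ts i).subst σ

/-- The term `u` matches the term `t`: some instance of `u` is `t`. (Only the values of `σ` on
the finitely many variables of `u` matter.) -/
def Term.Matches (u t : Term ar X) : Prop := ∃ σ : X → Term ar X, u.subst σ = t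

/-- `c.plug t` is the term `c[t]`. -/
def Ctx.plug : Ctx ar X → Term ar X → Term ar X
  | .hole, t => t
  | .app f i c ts, t => .app f fun j => if h : j = i then c.plug t else ts ⟨j, h⟩

/-- `c.comp d` is the one-hole term `c[d]`, the standard merging of contexts. -/
def Ctx.comp : Ctx ar X → Ctx ar X → Ctx ar X
  | .hole, d => d
  | .app f i c ts, d => .app f i (c.comp d) ts

end Terms

/-- Context-embedding strategies. Fixed-point variables are de Bruijn indices.
* `fail` is the failing strategy, `var n` a fixed-point variable;
* `pat u S` is `u; S`;
* `choice S S'` is the left choice `S ⊕ S'`;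
* `mu S` is `μX. S(X)`;
* `list I S τ` is the list `⋀_{i ∈ I} @i.S_i`, followed by the root insertion `@ε.c` when
  `τ = some c`. The positions of a list are pairwise distinct, and the order of the children in
  it is irrelevant. A single jump is the case of a singleton `I` and `τ = none`;
* `most S` applies `S` to all children of the root;
* `ite S S'` is `If S Then S'`. -/
inductive CE {F : Type*} (ar : F → ℕ) (X : Type*) where
  | fail : CE ar X
  | var (n : ℕ) : CE ar X
  | pat (u : Term ar X) (S : CE ar X) : CE ar X
  | choice (S S' : CE ar X) : CE ar X
  | mu (S : CE ar X) : CE ar X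
  | list (I : Finset ℕ) (S : {i : ℕ // i ∈ I} → CE ar X) (τ : Option (Ctx ar X)) : CE ar X
  | most (S : CE ar X) : CE ar X
  | ite (S S' : CE ar X) : CE ar X

namespace CE

variable {F : Type*} {ar : F → ℕ} {X : Type*}

/-- The insertion `@ε.c` of a context at the root. -/
def insertion (c : Ctx ar X) : CE ar X := .list ∅ (fun i => absurd i.2 (Finset.notMem_empty i.1)) (some c)

/-- All free fixed-point variables are smaller than `k`. -/
def ClosedBelow : CE ar X → ℕ → Prop
  | .fail, _ => True
  | .var n, k => n < k
  | .pat _ S, k => S.ClosedBelow k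
  | .choice S S', k => S.ClosedBelow k ∧ S'.ClosedBelow k
  | .mu S, k => S.ClosedBelow (k + 1)
  | .list _ S _, k => ∀ i, (S i).ClosedBelow k
  | .most S, k => S.ClosedBelow k
  | .ite S S', k => S.ClosedBelow k ∧ S'.ClosedBelow k

/-- Every free occurrence of the fixed-point variable `k` lies below a jump to a child or
below `most`. -/
def Guarded : CE ar X → ℕ → Prop
  | .fail, _ => True
  | .var n, k => n ≠ k
  | .pat _ S, k => S.Guarded k
  | .choice S S', k => S.Guarded k ∧ S'.Guarded k
  | .mu S, k => S.Guarded (k + 1)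
  | .list _ _ _, _ => True
  | .most _, _ => True
  | .ite S S', k => S.Guarded k ∧ S'.Guarded k

/-- Monotone strategies: in each fixed point `μX. S(X)`, the variable `X` is guarded. -/
def Monotone : CE ar X → Prop
  | .fail => True
  | .var _ => True
  | .pat _ S => S.Monotone
  | .choice S S' => S.Monotone ∧ S'.Monotone
  | .mu S => S.Guarded 0 ∧ S.Monotone
  | .list _ S _ => ∀ i, (S i).Monotone
  | .most S => S.Monotone
  | .ite S S' => S.Monotone ∧ S'.Monotone

/-- The strategies to which unification and combination apply: closed and monotone. -/
def Admissible (S : CE ar X) : Prop := S.ClosedBelow 0 ∧ S.Monotone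

/-- Substitution of a closed strategy `R` for the fixed-point variable `k`
(no lifting is needed because `R` is closed). -/
def inst (R : CE ar X) : CE ar X → ℕ → CE ar X
  | .fail, _ => .fail
  | .var n, k => if n = k then R else if k < n then .var (n - 1) else .var n
  | .pat u S, k => .pat u (inst R S k)
  | .choice S S', k => .choice (inst R S k) (inst R S' k)
  | .mu S, k => .mu (inst R S (k + 1))
  | .list I S τ, k => .list I (fun i => inst R (S i) k) τ
  | .most S, k => .most (inst R S k)
  | .ite S S', k => .ite (inst R S k) (inst R S' k)

/-- `S(μX. S(X))`, the unfolding of `μX. S(X)`. -/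
def unfold (S : CE ar X) : CE ar X := inst (.mu S) S 0

/-- Insertion of an optional context at the root. -/
def plugOpt : Option (Ctx ar X) → Term ar X → Term ar X
  | none, t => t
  | some c, t => c.plug t

/-- An environment extended by a value for the fixed-point variable `0`. -/
def push {α : Type*} (g : α) (ρ : ℕ → α) : ℕ → α
  | 0 => g
  | n + 1 => ρ n

open Classical in
/-- Semantics of strategies; `none` is failure, and `ρ` interprets free fixed-point variables.
A list first rewrites the children at its positions, where a child at which the strategy of
the list fails is left unchanged, then inserts its context (if any) at the root; it fails when
all its members fail. As the positions are those of distinct children, this is the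
composition of the members of the list in any order of the children. The value of `μX. S(X)`
at `t` is the value at `t` of the iterate `S(S(⋯S(fail)))` with `depth t + 1` copies of `S`. -/
noncomputable def sem : CE ar X → (ℕ → Term ar X → Option (Term ar X)) →
    Term ar X → Option (Term ar X)
  | .fail, _, _ => none
  | .var n, ρ, t => ρ n t
  | .pat u S, ρ, t => if u.Matches t then sem S ρ t else none
  | .choice S S', ρ, t => if sem S ρ t ≠ none then sem S ρ t else sem S' ρ t
  | .mu S, ρ, t => (fun g => sem S (push g ρ))^[t.depth + 1] (fun _ => none) t
  | .list _ _ τ, _, .var x => if τ ≠ none then some (plugOpt τ (.var x)) else none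
  | .list I S τ, ρ, .app f ts =>
      if τ ≠ none ∨ ∃ (i : Fin (ar f)) (h : (i : ℕ) ∈ I), sem (S ⟨i, h⟩) ρ (ts i) ≠ none then
        some (plugOpt τ (.app f fun i =>
          if h : (i : ℕ) ∈ I then (sem (S ⟨i, h⟩) ρ (ts i)).getD (ts i) else ts i))
      else none
  | .most _, _, .var _ => none
  | .most S, ρ, .app f ts =>
      if ∃ i, sem S ρ (ts i) ≠ none then
        some (.app f fun i => (sem S ρ (ts i)).getD (ts i))
      else none
  | .ite S S', ρ, t => if sem S ρ t ≠ none then sem S' ρ t else none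

/-- The semantics of a closed strategy. -/
noncomputable def eval (S : CE ar X) (t : Term ar X) : Option (Term ar X) :=
  S.sem (fun _ _ => none) t

/-- Semantic equivalence of closed strategies. -/
def Equivalent (S S' : CE ar X) : Prop := ∀ t, S.eval t = S'.eval t

/-- Rank of the head constructor of an argument in the priority order of the unification
rules. -/
def rank : CE ar X → ℕ
  | .fail => 0
  | .pat _ _ => 1
  | .choice _ _ => 2
  | .ite _ _ => 3
  | .list _ _ _ => 4
  | .most _ => 4
  | .mu _ => 5
  | .var _ => 6

/-- Merging of optional contexts. -/
def mergeOpt (m : Ctx ar X → Ctx ar X → Ctx ar X) :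
    Option (Ctx ar X) → Option (Ctx ar X) → Option (Ctx ar X)
  | some c, some d => some (m c d)
  | some c, none => some c
  | none, d => d

/-- The members of the unification of two lists: at a common position `i` it has
`R_i ⊕ S_i ⊕ S'_i`, elsewhere the member of the list that has one. -/
def mergeList {I J : Finset ℕ} (S : {i : ℕ // i ∈ I} → CE ar X)
    (S' : {i : ℕ // i ∈ J} → CE ar X) (R : {i : ℕ // i ∈ I ∩ J} → CE ar X) :
    {i : ℕ // i ∈ I ∪ J} → CE ar X := fun i =>
  if h : i.1 ∈ I then
    if h' : i.1 ∈ J then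
      .choice (R ⟨i.1, Finset.mem_inter.2 ⟨h, h'⟩⟩) (.choice (S ⟨i.1, h⟩) (S' ⟨i.1, h'⟩))
    else S ⟨i.1, h⟩
  else S' ⟨i.1, (Finset.mem_union.1 i.2).resolve_left h⟩

/-- The largest arity of a function symbol (for a signature of bounded arity). -/
noncomputable def maxArity (ar : F → ℕ) : ℕ := ⨆ f, ar f

/-- `Unif m M S S' R`: the tuple `⟨S, S', M⟩` has the normal form `R` for the reduction rules of
unification, where `m` is the merging of contexts. There is one constructor for each rule (the
rule for fixed points has two cases); the conditions on ranks and on the shape of lists express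
the priority order of the rules.

The memory `M` lists the pairs that have been unfolded on the way to the tuple, the most recent
one first. The unfolding of a pair binds a fresh fixed-point variable, so the variable of the
`n`-th pair in the memory has de Bruijn index `n`. -/
inductive Unif (m : Ctx ar X → Ctx ar X → Ctx ar X) :
    List (CE ar X × CE ar X) → CE ar X → CE ar X → CE ar X → Prop
  | failL {M} {S'} : Unif m M .fail S' .fail
  | failR {M} {S} : Unif m M S .fail .fail
  | insertion {M} (c d : Ctx ar X) :
      Unif m M (.insertion c) (.insertion d) (.insertion (m c d))
  | patL {M} {u} {S S' R} (hp : 0 < S'.rank) (h : Unif m M S S' R) :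
      Unif m M (.pat u S) S' (.pat u R)
  | patR {M} {u} {S S' R} (hp : 1 < S.rank) (h : Unif m M S S' R) :
      Unif m M S (.pat u S') (.pat u R)
  | jump {M} (i : ℕ) (S S' R : CE ar X) (h : Unif m M S S' R) :
      Unif m M (.list {i} (fun _ => S) none) (.list {i} (fun _ => S') none)
        (.list {i} (fun _ => R) none)
  | list {M} {I J : Finset ℕ} {S : {i : ℕ // i ∈ I} → CE ar X}
      {S' : {i : ℕ // i ∈ J} → CE ar X} {τ τ' : Option (Ctx ar X)}
      (R : {i : ℕ // i ∈ I ∩ J} → CE ar X)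
      (hins : ¬ (I = ∅ ∧ J = ∅ ∧ τ ≠ none ∧ τ' ≠ none))
      (hjump : ¬ (I = J ∧ I.card = 1 ∧ τ = none ∧ τ' = none))
      (h : ∀ i, Unif m M (S ⟨i.1, (Finset.mem_inter.1 i.2).1⟩)
        (S' ⟨i.1, (Finset.mem_inter.1 i.2).2⟩) (R i)) :
      Unif m M (.list I S τ) (.list J S' τ')
        (.ite (.list I S τ) (.ite (.list J S' τ')
          (.list (I ∪ J) (mergeList S S' R) (mergeOpt m τ τ'))))
  | choiceL {M} {S₁ S₂ S' R₁ R₂} (hp : 1 < S'.rank) (h₁ : Unif m M S₁ S' R₁)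
      (h₂ : Unif m M S₂ S' R₂) : Unif m M (.choice S₁ S₂) S' (.choice R₁ R₂)
  | choiceR {M} {S S₁ S₂ R₁ R₂} (hp : 2 < S.rank) (h₁ : Unif m M S S₁ R₁)
      (h₂ : Unif m M S S₂ R₂) : Unif m M S (.choice S₁ S₂) (.choice R₁ R₂)
  | iteL {M} {S₁ S₂ S' R} (hp : 2 < S'.rank) (h : Unif m M S₂ S' R) :
      Unif m M (.ite S₁ S₂) S' (.ite S₁ R)
  | iteR {M} {S S₁ S₂ R} (hp : 3 < S.rank) (h : Unif m M S S₂ R) :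
      Unif m M S (.ite S₁ S₂) (.ite S₁ R)
  | most {M} {S S' R} (h : Unif m M S S' R) :
      Unif m M (.most S) (.most S')
        (.ite (.most S) (.ite (.most S') (.most (.choice R (.choice S S')))))
  | mostL {M} {S} {J : Finset ℕ} {S' : {i : ℕ // i ∈ J} → CE ar X} {τ'} {R}
      (h : Unif m M (.list (Finset.range (maxArity ar)) (fun _ => S) none) (.list J S' τ') R) :
      Unif m M (.most S) (.list J S' τ') R
  | mostR {M} {I : Finset ℕ} {S : {i : ℕ // i ∈ I} → CE ar X} {τ} {S'} {R}
      (h : Unif m M (.list I S τ) (.list (Finset.range (maxArity ar)) (fun _ => S') none) R) :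
      Unif m M (.list I S τ) (.most S') R
  | muL {M} {S S' R} (hp : 3 < S'.rank) (hM : (CE.mu S, S') ∉ M)
      (h : Unif m ((CE.mu S, S') :: M) S.unfold S' R) : Unif m M (.mu S) S' (.mu R)
  | muLVar {M} {S S'} (n : ℕ) (hp : 3 < S'.rank) (hM : M[n]? = some (CE.mu S, S')) :
      Unif m M (.mu S) S' (.var n)
  | muR {M} {S S' R} (hp : S.rank = 4) (hM : (S, CE.mu S') ∉ M)
      (h : Unif m ((S, CE.mu S') :: M) S S'.unfold R) : Unif m M S (.mu S') (.mu R)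
  | muRVar {M} {S S'} (n : ℕ) (hp : S.rank = 4) (hM : M[n]? = some (S, CE.mu S')) :
      Unif m M S (.mu S') (.var n)

open Classical in
/-- The unification of two strategies: the normal form of `⟨S, S', ∅⟩`. -/
noncomputable def unify (m : Ctx ar X → Ctx ar X → Ctx ar X) (S S' : CE ar X) : CE ar X :=
  if h : ∃ R, Unif m [] S S' R then h.choose else .fail

/-- The combination `(S ⋏ S') ⊕ S ⊕ S'` of two strategies. -/
noncomputable def comb (m : Ctx ar X → Ctx ar X → Ctx ar X) (S S' : CE ar X) : CE ar X :=
  .choice (unify m S S') (.choice S S')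

end CE

end CES

/-! ### Plans: insertions recorded position by position -/

namespace CES

section Plans

variable {F : Type*} {ar : F → ℕ} {X : Type*}

/-! The term produced by a strategy does not show where contexts were inserted, so the effect of
`comb` cannot be read off from the two outputs. The proof therefore passes to a finer semantics: on
each term a strategy fails or yields a plan, a partial function from positions to contexts, and
`eval` carries out that plan (`eval_eq_map_closedPlan`). In this semantics unification merges the
two plans pointwise by `m` and fails if either strategy fails (`Unif.plan_eq`). Hence combination is
`Option.merge` of plans (`closedPlan_comb`), with failure as neutral element, and associativity,
commutativity and idempotency of `m` pass to it entry by entry. Conversely, these laws for `m` are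
recovered from root insertions, because a context is determined by the terms it yields
(`Ctx.eq_of_plug_eq`).

For fixed points, a guarded body consults its variable only at terms of smaller depth, so it has
exactly one fixed point. It thus suffices to check that the merged plans solve the equation of the
new binder, when each memory variable is read as the merge of its pair. The new binder is itself
guarded: unfolding a guarded fixed point lowers `headDepth`, and this quantity cannot grow again
before a list or `most` is crossed in the result (`Unif.guarded`).

Normal forms exist because only finitely many strategies are reachable from a closed one
(`exists_finset_succ_closed`). The memory never repeats a pair, so only boundedly many unfoldings
occur, and between two of them `weight` decreases. Uniqueness holds because ranks and list shapes
make the rules exclusive, and a pair occurs at one index only of a memory without repetitions. -/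

/-- The `i`-th child of a term, if it exists. -/
def Term.child? : Term ar X → ℕ → Option (Term ar X)
  | .var _, _ => none
  | .app f ts, i => if h : i < ar f then some (ts ⟨i, h⟩) else none

theorem Term.depth_lt_of_child? {t s : Term ar X} {i : ℕ} (h : t.child? i = some s) :
    s.depth < t.depth := by
  cases t with
  | var x => simp [Term.child?] at h
  | app f ts =>
    simp only [Term.child?] at h
    split_ifs at h with hi
    cases h
    exact Nat.lt_of_succ_le (Finset.le_sup (f := fun i => (ts i).depth + 1) (Finset.mem_univ _))

/-- A plan assigns to each position of a term the context to be inserted there, if any. -/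
abbrev Plan (ar : F → ℕ) (X : Type*) := List ℕ → Option (Ctx ar X)

namespace Plan

/-- The plan with root insertion `τ` and with the plan `ch i` (if any) below the child `i`. -/
def node (τ : Option (Ctx ar X)) (ch : ℕ → Option (Plan ar X)) : Plan ar X
  | [] => τ
  | i :: l => (ch i).bind fun p => p l

open Classical in
/-- The plan `node τ ch`, or failure when neither the root nor any child is touched. -/
noncomputable def tryNode (τ : Option (Ctx ar X)) (ch : ℕ → Option (Plan ar X)) :
    Option (Plan ar X) :=
  if τ ≠ none ∨ ∃ i, ch i ≠ none then some (node τ ch) else none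

/-- Pointwise merging of plans. -/
def merge (m : Ctx ar X → Ctx ar X → Ctx ar X) (p q : Plan ar X) : Plan ar X :=
  fun l => Option.merge m (p l) (q l)

theorem merge_node (m : Ctx ar X → Ctx ar X → Ctx ar X) (τ τ' : Option (Ctx ar X))
    (ch ch' : ℕ → Option (Plan ar X)) :
    merge m (node τ ch) (node τ' ch') =
      node (Option.merge m τ τ') fun i => Option.merge (merge m) (ch i) (ch' i) := by
  funext l
  cases l with
  | nil => rfl
  | cons i l =>
    simp only [merge, node]
    cases ch i <;> cases ch' i <;> simp [merge]

/-- Merging loses no entry, so once both factors succeed the merged node succeeds too. The two binds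
mirror the nested `If` tests in the rules for lists and `most`. -/
theorem map₂_tryNode (m : Ctx ar X → Ctx ar X → Ctx ar X) (τ τ' : Option (Ctx ar X))
    (ch ch' : ℕ → Option (Plan ar X)) :
    Option.map₂ (merge m) (tryNode τ ch) (tryNode τ' ch') =
      (tryNode τ ch).bind fun _ => (tryNode τ' ch').bind fun _ =>
        tryNode (Option.merge m τ τ') fun i => Option.merge (merge m) (ch i) (ch' i) := by
  by_cases h : τ ≠ none ∨ ∃ i, ch i ≠ none
  · by_cases h' : τ' ≠ none ∨ ∃ i, ch' i ≠ none
    · have h'' : Option.merge m τ τ' ≠ none ∨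
          ∃ i, Option.merge (merge m) (ch i) (ch' i) ≠ none := by
        rcases h with h | ⟨i, h⟩
        · left
          simp [Option.merge_eq_none_iff, h]
        · exact Or.inr ⟨i, by simp [Option.merge_eq_none_iff, h]⟩
      simp only [tryNode, if_pos h, if_pos h', if_pos h'', Option.map₂_some_some,
        Option.bind_some, merge_node]
    · simp only [tryNode, if_neg h', Option.map₂_none_right, Option.bind_none, Option.bind_fun_none]
  · simp only [tryNode, if_neg h, Option.map₂_none_left, Option.bind_none]

/-- The plan that carries out `p` at the child `i`. -/
def single (i : ℕ) (p : Plan ar X) : Plan ar X :=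
  node none fun j => if j = i then some p else none

theorem merge_single (m : Ctx ar X → Ctx ar X → Ctx ar X) (i : ℕ) (p q : Plan ar X) :
    merge m (single i p) (single i q) = single i (merge m p q) := by
  rw [single, single, merge_node, single]
  congr 1
  funext j
  split_ifs <;> rfl

/-- A single jump fails exactly when its child is missing or fails; this is why the jump rule needs
no `If` tests. -/
theorem tryNode_child (t : Term ar X) (i : ℕ) (f : Term ar X → Option (Plan ar X)) :
    tryNode none (fun j => if j = i then (t.child? j).bind f else none) =
      ((t.child? i).bind f).map (single i) := by
  have h : (fun j => if j = i then (t.child? j).bind f else none) =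
      fun j => if j = i then (t.child? i).bind f else none :=
    funext fun j => if_ctx_congr Iff.rfl (fun h => by rw [h]) fun _ => rfl
  rw [h]
  cases (t.child? i).bind f <;> simp [tryNode, single]

/-- The pattern `R ⊕ S ⊕ S'` occurs at common children, below `most` and in `comb` itself; each time
it turns a strict merge into one with failure as neutral element. -/
theorem map₂_or_or {α : Type*} (f : α → α → α) (a b : Option α) :
    (Option.map₂ f a b).or (a.or b) = Option.merge f a b := by
  cases a <;> cases b <;> rfl

end Plan

/-- The result of carrying out a plan on a term. -/
def Term.embed : Term ar X → Plan ar X → Term ar X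
  | .var x, p => CE.plugOpt (p []) (.var x)
  | .app f ts, p => CE.plugOpt (p []) (.app f fun i => (ts i).embed fun l => p (i :: l))

theorem Term.embed_none (t : Term ar X) : t.embed (fun _ => none) = t := by
  induction t with
  | var x => rfl
  | app f ts ih => simp only [Term.embed, CE.plugOpt, ih]

/-! ### Plan semantics of strategies -/

namespace CE

open Classical in
/-- The plan that a strategy carries out on a term; `none` is failure. -/
noncomputable def plan : CE ar X → (ℕ → Term ar X → Option (Plan ar X)) →
    Term ar X → Option (Plan ar X)
  | .fail, _, _ => none
  | .var n, ρ, t => ρ n t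
  | .pat u S, ρ, t => if u.Matches t then plan S ρ t else none
  | .choice S S', ρ, t => (plan S ρ t).or (plan S' ρ t)
  | .mu S, ρ, t => (fun g => plan S (push g ρ))^[t.depth + 1] (fun _ => none) t
  | .list I S τ, ρ, t => Plan.tryNode τ fun i =>
      if h : i ∈ I then (t.child? i).bind fun s => plan (S ⟨i, h⟩) ρ s else none
  | .most S, ρ, t => Plan.tryNode none fun i => (t.child? i).bind fun s => plan S ρ s
  | .ite S S', ρ, t => (plan S ρ t).bind fun _ => plan S' ρ t

theorem plan_ite (S S' : CE ar X) (ρ : ℕ → Term ar X → Option (Plan ar X)) (t : Term ar X) :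
    (CE.ite S S').plan ρ t = (S.plan ρ t).bind fun _ => S'.plan ρ t := rfl

theorem map_embed_tryNode_var (τ : Option (Ctx ar X)) (x : X) :
    (Plan.tryNode τ fun _ => none).map ((Term.var x).embed) =
      if τ ≠ none then some (plugOpt τ (.var x)) else none := by
  cases τ <;> simp [Plan.tryNode, Term.embed, Plan.node]

/-- `tryNode` tests all natural numbers for a touched child, the semantics only actual children;
`hch` makes the two tests agree. -/
theorem map_embed_tryNode_app (τ : Option (Ctx ar X)) (f : F) (ts : Fin (ar f) → Term ar X)
    (ch : ℕ → Option (Plan ar X)) (hch : ∀ i, ¬ i < ar f → ch i = none) :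
    (Plan.tryNode τ ch).map ((Term.app f ts).embed) =
      if τ ≠ none ∨ ∃ i : Fin (ar f), (ch i).map (ts i).embed ≠ none then
        some (plugOpt τ (.app f fun i => ((ch i).map (ts i).embed).getD (ts i))) else none := by
  have hiff : (τ ≠ none ∨ ∃ i : Fin (ar f), (ch i).map (ts i).embed ≠ none) ↔
      (τ ≠ none ∨ ∃ i, ch i ≠ none) := by
    refine or_congr_right ⟨fun ⟨i, hi⟩ => ⟨i, by simpa using hi⟩, fun ⟨i, hi⟩ => ?_⟩
    by_cases h : i < ar f
    · exact ⟨⟨i, h⟩, by simpa using hi⟩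
    · exact absurd (hch i h) hi
  have hres : (Term.app f ts).embed (Plan.node τ ch) =
      plugOpt τ (.app f fun i => ((ch i).map (ts i).embed).getD (ts i)) := by
    simp only [Term.embed, Plan.node]
    congr 2
    funext i
    cases ch i <;> simp [Term.embed_none]
  unfold Plan.tryNode
  by_cases h : τ ≠ none ∨ ∃ i, ch i ≠ none
  · rw [if_pos h, if_pos (hiff.2 h), Option.map_some, hres]
  · rw [if_neg h, if_neg (fun h' => h (hiff.1 h')), Option.map_none]

theorem sem_eq_map_plan (S : CE ar X) : ∀ (ρ : ℕ → Term ar X → Option (Term ar X))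
    (π : ℕ → Term ar X → Option (Plan ar X)) (_ : ∀ n t, ρ n t = (π n t).map t.embed)
    (t : Term ar X), S.sem ρ t = (S.plan π t).map t.embed := by
  induction S with
  | fail => intros; rfl
  | var n => intro ρ π h t; exact h n t
  | pat u S ih =>
    intro ρ π h t
    simp only [sem, plan, ih ρ π h t]
    split_ifs <;> rfl
  | choice S S' ih ih' =>
    intro ρ π h t
    simp only [sem, plan, ih ρ π h t, ih' ρ π h t]
    cases S.plan π t <;> simp
  | ite S S' ih ih' =>
    intro ρ π h t
    simp only [sem, plan, ih ρ π h t, ih' ρ π h t]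
    cases S.plan π t <;> simp
  | mu S ih =>
    intro ρ π h t
    simp only [sem, plan]
    -- The number of iterates depends on `t`; it is freed so that the induction compares the
    -- iterates at all terms.
    generalize t.depth + 1 = k
    induction k generalizing t with
    | zero => rfl
    | succ k ihk =>
      rw [Function.iterate_succ_apply', Function.iterate_succ_apply']
      refine ih _ _ (fun n s => ?_) t
      cases n with
      | zero => exact ihk s
      | succ n => exact h n s
  | list I S τ ih =>
    intro ρ π h t
    cases t with
    | var x =>
      simp only [sem, plan, Term.child?, Option.bind_none, dite_eq_ite, ite_self,
        map_embed_tryNode_var]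
    | app f ts =>
      rw [plan, map_embed_tryNode_app _ _ _ _ (fun i hi => by simp [Term.child?, hi])]
      have key : ∀ i : Fin (ar f), (if h : (i : ℕ) ∈ I then
          ((Term.app f ts).child? i).bind fun s => plan (S ⟨i, h⟩) π s else none).map (ts i).embed
          = if h : (i : ℕ) ∈ I then sem (S ⟨i, h⟩) ρ (ts i) else none := by
        intro i
        split_ifs with hi
        · simp [Term.child?, ih _ ρ π h]
        · rfl
      simp only [key, sem]
      refine if_congr ?_ ?_ rfl
      · refine or_congr_right (exists_congr fun i => ?_)
        by_cases hi : (i : ℕ) ∈ I <;> simp [hi]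
      · congr 3
        funext i
        split_ifs <;> rfl
  | most S ih =>
    intro ρ π h t
    cases t with
    | var x =>
      simp only [sem, plan, Term.child?, Option.bind_none, map_embed_tryNode_var]
      simp
    | app f ts =>
      rw [plan, map_embed_tryNode_app _ _ _ _ (fun i hi => by simp [Term.child?, hi])]
      have key : ∀ i : Fin (ar f),
          (((Term.app f ts).child? i).bind fun s => plan S π s).map (ts i).embed
          = sem S ρ (ts i) := by
        intro i
        simp [Term.child?, ih ρ π h]
      simp only [key, sem]
      simp [plugOpt]

/-- The plan of a closed strategy. -/
noncomputable def closedPlan (S : CE ar X) (t : Term ar X) : Option (Plan ar X) :=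
  S.plan (fun _ _ => none) t

theorem eval_eq_map_closedPlan (S : CE ar X) (t : Term ar X) :
    S.eval t = (S.closedPlan t).map t.embed :=
  sem_eq_map_plan S _ (fun _ _ => none) (fun _ _ => rfl) t

/-! ### Guarded fixed points, substitution and unfolding -/

/-- The plan at `t` depends on unguarded variables at terms of depth at most that of `t`, and on
guarded ones at terms of smaller depth. -/
theorem plan_congr_of_depth (S : CE ar X) : ∀ (ρ ρ' : ℕ → Term ar X → Option (Plan ar X)) (d : ℕ)
    (_ : ∀ n s, s.depth < d → ρ n s = ρ' n s)
    (_ : ∀ n s, ¬ S.Guarded n → s.depth ≤ d → ρ n s = ρ' n s)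
    (t : Term ar X) (_ : t.depth ≤ d), S.plan ρ t = S.plan ρ' t := by
  induction S with
  | fail => intros; rfl
  | var n => intro ρ ρ' d _ h t ht; exact h n t (by simp [Guarded]) ht
  | pat u S ih =>
    intro ρ ρ' d hlt hle t ht
    simp only [plan, ih ρ ρ' d hlt hle t ht]
  | choice S S' ih ih' =>
    intro ρ ρ' d hlt hle t ht
    simp only [plan, ih ρ ρ' d hlt (fun n s hn => hle n s fun h => hn h.1) t ht,
      ih' ρ ρ' d hlt (fun n s hn => hle n s fun h => hn h.2) t ht]
  | ite S S' ih ih' =>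
    intro ρ ρ' d hlt hle t ht
    simp only [plan, ih ρ ρ' d hlt (fun n s hn => hle n s fun h => hn h.1) t ht,
      ih' ρ ρ' d hlt (fun n s hn => hle n s fun h => hn h.2) t ht]
  | mu S ih =>
    intro ρ ρ' d hlt hle t ht
    simp only [plan]
    generalize t.depth + 1 = k
    induction k generalizing t with
    | zero => rfl
    | succ k ihk =>
      rw [Function.iterate_succ_apply', Function.iterate_succ_apply']
      refine ih _ _ d (fun n s hs => ?_) (fun n s hn hs => ?_) t ht
      · cases n with
        | zero => exact ihk s hs.le
        | succ n => exact hlt n s hs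
      · cases n with
        | zero => exact ihk s hs
        | succ n => exact hle n s hn hs
  | list I S τ ih =>
    intro ρ ρ' d hlt _ t ht
    simp only [plan]
    congr 1
    funext i
    split_ifs with hi
    · refine Option.bind_congr fun s hs => ?_
      -- Below a jump the depth bound drops to that of the child, so guarded and unguarded variables
      -- are both covered by `hlt`.
      have hs' := (Term.depth_lt_of_child? hs).trans_le ht
      exact ih _ ρ ρ' s.depth (fun n r hr => hlt n r (hr.trans hs'))
        (fun n r _ hr => hlt n r (hr.trans_lt hs')) s le_rfl
    · rfl
  | most S ih =>
    intro ρ ρ' d hlt _ t ht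
    simp only [plan]
    congr 1
    funext i
    refine Option.bind_congr fun s hs => ?_
    have hs' := (Term.depth_lt_of_child? hs).trans_le ht
    exact ih ρ ρ' s.depth (fun n r hr => hlt n r (hr.trans hs'))
      (fun n r _ hr => hlt n r (hr.trans_lt hs')) s le_rfl

theorem plan_push_congr {S : CE ar X} (hS : S.Guarded 0)
    {ρ : ℕ → Term ar X → Option (Plan ar X)} {g g' : Term ar X → Option (Plan ar X)}
    {t : Term ar X} (h : ∀ s, s.depth < t.depth → g s = g' s) :
    S.plan (push g ρ) t = S.plan (push g' ρ) t := by
  refine plan_congr_of_depth S _ _ t.depth (fun n s hs => ?_) (fun n s hn _ => ?_) t le_rfl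
  · cases n with
    | zero => exact h s hs
    | succ n => rfl
  · cases n with
    | zero => exact absurd hS hn
    | succ n => rfl

/-- A guarded body has a unique fixed point, which is the plan of `μX. S(X)`. -/
theorem plan_mu_eq_of_fixed {S : CE ar X} (hS : S.Guarded 0)
    {ρ : ℕ → Term ar X → Option (Plan ar X)} {g : Term ar X → Option (Plan ar X)}
    (hg : ∀ t, S.plan (push g ρ) t = g t) (t : Term ar X) : (CE.mu S).plan ρ t = g t := by
  -- The `k`-th iterate is already correct at all terms of depth below `k`, since a guarded body
  -- looks one level deeper.
  have key : ∀ (k : ℕ) (t : Term ar X), t.depth < k →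
      (fun g => S.plan (push g ρ))^[k] (fun _ => none) t = g t := by
    intro k
    induction k with
    | zero => intro t ht; omega
    | succ k ih =>
      intro t ht
      rw [Function.iterate_succ_apply', ← hg t]
      exact plan_push_congr hS fun s hs => ih s (by omega)
  exact key _ t (Nat.lt_succ_self _)

/-- Iterates stabilise: at a given term any two counts exceeding its depth give the same value. This
is needed because `mu` uses a different count at each subterm. -/
theorem plan_mu_fixed {S : CE ar X} (hS : S.Guarded 0)
    (ρ : ℕ → Term ar X → Option (Plan ar X)) (t : Term ar X) :
    S.plan (push ((CE.mu S).plan ρ) ρ) t = (CE.mu S).plan ρ t := by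
  have key : ∀ (k l : ℕ) (t : Term ar X), t.depth < k → t.depth < l →
      (fun g => S.plan (push g ρ))^[k] (fun _ => none) t =
        (fun g => S.plan (push g ρ))^[l] (fun _ => none) t := by
    intro k
    induction k with
    | zero => intro l t ht; omega
    | succ k ih =>
      intro l t ht hl
      cases l with
      | zero => omega
      | succ l =>
        rw [Function.iterate_succ_apply', Function.iterate_succ_apply']
        exact plan_push_congr hS fun s hs => ih l s (by omega) (by omega)
  -- After one body is peeled off, the right side uses `t.depth` iterates and the left side `s.depth
  -- + 1`; both exceed `s.depth`.
  conv_rhs => rw [plan, Function.iterate_succ_apply']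
  exact plan_push_congr hS fun s hs => key _ _ s (Nat.lt_succ_self _) hs

theorem plan_congr_of_closedBelow (S : CE ar X) :
    ∀ (k : ℕ) (_ : S.ClosedBelow k) (ρ ρ' : ℕ → Term ar X → Option (Plan ar X))
      (_ : ∀ n < k, ρ n = ρ' n), S.plan ρ = S.plan ρ' := by
  induction S with
  | fail => intros; rfl
  | var n => intro k hk ρ ρ' h; exact h n hk
  | pat u S ih =>
    intro k hk ρ ρ' h; funext t
    simp only [plan, ih k hk ρ ρ' h]
  | choice S S' ih ih' =>
    intro k hk ρ ρ' h; funext t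
    simp only [plan, ih k hk.1 ρ ρ' h, ih' k hk.2 ρ ρ' h]
  | ite S S' ih ih' =>
    intro k hk ρ ρ' h; funext t
    simp only [plan, ih k hk.1 ρ ρ' h, ih' k hk.2 ρ ρ' h]
  | mu S ih =>
    intro k hk ρ ρ' h; funext t
    have : ∀ g, S.plan (push g ρ) = S.plan (push g ρ') := fun g =>
      ih (k + 1) hk _ _ fun n hn => by
        cases n with
        | zero => rfl
        | succ n => exact h n (by omega)
    simp only [plan, this]
  | list I S τ ih =>
    intro k hk ρ ρ' h; funext t
    simp only [plan, fun i => ih i k (hk i) ρ ρ' h]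
  | most S ih =>
    intro k hk ρ ρ' h; funext t
    simp only [plan, ih k hk ρ ρ' h]

theorem plan_eq_closedPlan {S : CE ar X} (hS : S.ClosedBelow 0)
    (ρ : ℕ → Term ar X → Option (Plan ar X)) : S.plan ρ = S.closedPlan :=
  plan_congr_of_closedBelow S 0 hS _ _ fun _ hn => absurd hn (Nat.not_lt_zero _)

/-- Substitution lemma: `ρ'` is `ρ` with the plan of `R` inserted at index `k` and the later entries
shifted. -/
theorem plan_inst {R : CE ar X} (hR : R.ClosedBelow 0) (S : CE ar X) :
    ∀ (k : ℕ) (ρ ρ' : ℕ → Term ar X → Option (Plan ar X)) (_ : ρ' k = R.closedPlan)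
      (_ : ∀ n < k, ρ' n = ρ n) (_ : ∀ n, k ≤ n → ρ' (n + 1) = ρ n),
      (inst R S k).plan ρ = S.plan ρ' := by
  induction S with
  | fail => intros; rfl
  | var n =>
    intro k ρ ρ' hk hlt hge
    simp only [inst]
    split_ifs with h h'
    · subst h
      rw [plan_eq_closedPlan hR]
      exact hk.symm
    · obtain ⟨n, rfl⟩ : ∃ j, n = j + 1 := ⟨n - 1, by omega⟩
      exact (hge n (by omega)).symm
    · exact (hlt n (by omega)).symm
  | pat u S ih =>
    intro k ρ ρ' hk hlt hge; funext t
    simp only [inst, plan, ih k ρ ρ' hk hlt hge]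
  | choice S S' ih ih' =>
    intro k ρ ρ' hk hlt hge; funext t
    simp only [inst, plan, ih k ρ ρ' hk hlt hge, ih' k ρ ρ' hk hlt hge]
  | ite S S' ih ih' =>
    intro k ρ ρ' hk hlt hge; funext t
    simp only [inst, plan, ih k ρ ρ' hk hlt hge, ih' k ρ ρ' hk hlt hge]
  | mu S ih =>
    intro k ρ ρ' hk hlt hge; funext t
    have : ∀ g, (inst R S (k + 1)).plan (push g ρ) = S.plan (push g ρ') := fun g => by
      refine ih (k + 1) _ _ hk (fun n hn => ?_) (fun n hn => ?_)
      · cases n with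
        | zero => rfl
        | succ n => exact hlt n (by omega)
      · cases n with
        | zero => omega
        | succ n => exact hge n (by omega)
    simp only [inst, plan, this]
  | list I S τ ih =>
    intro k ρ ρ' hk hlt hge; funext t
    simp only [inst, plan, fun i => ih i k ρ ρ' hk hlt hge]
  | most S ih =>
    intro k ρ ρ' hk hlt hge; funext t
    simp only [inst, plan, ih k ρ ρ' hk hlt hge]

theorem closedPlan_unfold {S : CE ar X} (hS : (CE.mu S).Admissible) :
    S.unfold.closedPlan = (CE.mu S).closedPlan := by
  funext t
  have h := plan_inst hS.1 S 0 (fun _ _ => none) (push ((CE.mu S).closedPlan) fun _ _ => none)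
    rfl (fun n hn => absurd hn (Nat.not_lt_zero _)) (fun _ _ => rfl)
  exact (congrFun h t).trans (plan_mu_fixed hS.2.1 _ t)

end CE

end Plans

end CES

/-! ### Closedness, guardedness and head depth under substitution -/

namespace CES

namespace CE

variable {F : Type*} {ar : F → ℕ} {X : Type*}

theorem ClosedBelow.mono {S : CE ar X} : ∀ {k l : ℕ}, S.ClosedBelow k → k ≤ l → S.ClosedBelow l := by
  induction S with
  | fail => intros; trivial
  | var n => intro k l h hl; exact lt_of_lt_of_le h hl
  | pat u S ih => intro k l h hl; exact ih (k := k) h hl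
  | choice S S' ih ih' => intro k l h hl; exact ⟨ih h.1 hl, ih' h.2 hl⟩
  | ite S S' ih ih' => intro k l h hl; exact ⟨ih h.1 hl, ih' h.2 hl⟩
  | mu S ih => intro k l h hl; exact ih (k := k + 1) h (by omega)
  | list I S τ ih => intro k l h hl i; exact ih i (h i) hl
  | most S ih => intro k l h hl; exact ih (k := k) h hl

theorem ClosedBelow.guarded {S : CE ar X} :
    ∀ {k n : ℕ}, S.ClosedBelow k → k ≤ n → S.Guarded n := by
  induction S with
  | fail => intros; trivial
  | var n => intro k l h hl; exact (lt_of_lt_of_le h hl).ne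
  | pat u S ih => intro k l h hl; exact ih (k := k) h hl
  | choice S S' ih ih' => intro k l h hl; exact ⟨ih h.1 hl, ih' h.2 hl⟩
  | ite S S' ih ih' => intro k l h hl; exact ⟨ih h.1 hl, ih' h.2 hl⟩
  | mu S ih => intro k l h hl; exact ih (k := k + 1) h (by omega)
  | list I S τ ih => intros; trivial
  | most S ih => intros; trivial

theorem ClosedBelow.inst {R : CE ar X} (hR : R.ClosedBelow 0) (S : CE ar X) :
    ∀ {k : ℕ}, S.ClosedBelow (k + 1) → (inst R S k).ClosedBelow k := by
  induction S with
  | fail => intros; trivial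
  | var n =>
    intro k h
    have h : n < k + 1 := h
    simp only [CE.inst]
    split_ifs
    · exact hR.mono (Nat.zero_le _)
    · omega
    · exact (by omega : n < k)
  | pat u S ih => intro k h; exact ih (k := k) h
  | choice S S' ih ih' => intro k h; exact ⟨ih h.1, ih' h.2⟩
  | ite S S' ih ih' => intro k h; exact ⟨ih h.1, ih' h.2⟩
  | mu S ih => intro k h; exact ih (k := k + 1) h
  | list I S τ ih => intro k h i; exact ih i (h i)
  | most S ih => intro k h; exact ih (k := k) h

theorem ClosedBelow.inst_eq (R : CE ar X) {S : CE ar X} :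
    ∀ {k : ℕ}, S.ClosedBelow k → CE.inst R S k = S := by
  induction S with
  | fail => intros; rfl
  | var n =>
    intro k h
    have h : n < k := h
    simp only [CE.inst]
    rw [if_neg (by omega), if_neg (by omega)]
  | pat u S ih => intro k h; simp only [CE.inst, ih (k := k) h]
  | choice S S' ih ih' => intro k h; simp only [CE.inst, ih h.1, ih' h.2]
  | ite S S' ih ih' => intro k h; simp only [CE.inst, ih h.1, ih' h.2]
  | mu S ih => intro k h; simp only [CE.inst, ih (k := k + 1) h]
  | list I S τ ih => intro k h; simp only [CE.inst, fun i => ih i (h i)]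
  | most S ih => intro k h; simp only [CE.inst, ih (k := k) h]

theorem Guarded.inst {R : CE ar X} (hR : R.ClosedBelow 0) (S : CE ar X) :
    ∀ {j k : ℕ}, S.Guarded j → j < k → (CE.inst R S k).Guarded j := by
  induction S with
  | fail => intros; trivial
  | var n =>
    intro j k h hj
    have h : n ≠ j := h
    simp only [CE.inst]
    split_ifs
    · exact hR.guarded (Nat.zero_le _)
    · exact (by omega : n - 1 ≠ j)
    · exact h
  | pat u S ih => intro j k h hj; exact ih (j := j) h hj
  | choice S S' ih ih' => intro j k h hj; exact ⟨ih h.1 hj, ih' h.2 hj⟩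
  | ite S S' ih ih' => intro j k h hj; exact ⟨ih h.1 hj, ih' h.2 hj⟩
  | mu S ih => intro j k h hj; exact ih (j := j + 1) (k := k + 1) h (by omega)
  | list I S τ ih => intros; trivial
  | most S ih => intros; trivial

theorem Monotone.inst {R : CE ar X} (hR : R.Admissible) (S : CE ar X) :
    ∀ {k : ℕ}, S.Monotone → (CE.inst R S k).Monotone := by
  induction S with
  | fail => intros; trivial
  | var n =>
    intro k h
    simp only [CE.inst]
    split_ifs
    · exact hR.2
    · trivial
    · trivial
  | pat u S ih => intro k h; exact ih (k := k) h
  | choice S S' ih ih' => intro k h; exact ⟨ih h.1, ih' h.2⟩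
  | ite S S' ih ih' => intro k h; exact ⟨ih h.1, ih' h.2⟩
  | mu S ih => intro k h; exact ⟨Guarded.inst hR.1 S h.1 (Nat.succ_pos k), ih h.2⟩
  | list I S τ ih => intro k h i; exact ih i (h i)
  | most S ih => intro k h; exact ih (k := k) h

theorem Admissible.unfold {S : CE ar X} (hS : (CE.mu S).Admissible) : S.unfold.Admissible :=
  ⟨ClosedBelow.inst hS.1 S hS.1, Monotone.inst hS S hS.2.2⟩

/-- The number of constructors above the next list, `most` or variable. -/
def headDepth : CE ar X → ℕ
  | .fail => 0
  | .var _ => 0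
  | .pat _ S => S.headDepth + 1
  | .choice S S' => max S.headDepth S'.headDepth + 1
  | .mu S => S.headDepth + 1
  | .list _ _ _ => 0
  | .most _ => 0
  | .ite S S' => max S.headDepth S'.headDepth + 1

/-- A guarded variable occurs only below a list or `most`, where `headDepth` no longer looks. -/
theorem headDepth_inst (R S : CE ar X) :
    ∀ {k : ℕ}, S.Guarded k → (inst R S k).headDepth = S.headDepth := by
  induction S with
  | fail => intros; rfl
  | var n =>
    intro k h
    have h : n ≠ k := h
    simp only [CE.inst, if_neg h]
    split_ifs <;> rfl
  | pat u S ih => intro k h; simp only [inst, headDepth, ih (k := k) h]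
  | choice S S' ih ih' => intro k h; simp only [inst, headDepth, ih h.1, ih' h.2]
  | ite S S' ih ih' => intro k h; simp only [inst, headDepth, ih h.1, ih' h.2]
  | mu S ih => intro k h; simp only [inst, headDepth, ih (k := k + 1) h]
  | list I S τ ih => intros; rfl
  | most S ih => intros; rfl

theorem headDepth_unfold_lt {S : CE ar X} (hS : S.Guarded 0) :
    S.unfold.headDepth < (CE.mu S).headDepth := by
  rw [CE.unfold, headDepth_inst _ _ hS, headDepth]
  exact Nat.lt_succ_self _

/-! ### Finiteness of the set of reachable strategies -/

/-- Simultaneous substitution of closed strategies for the fixed-point variables from `d` on. -/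
def close (E : ℕ → CE ar X) : CE ar X → ℕ → CE ar X
  | .fail, _ => .fail
  | .var n, d => if n < d then .var n else E (n - d)
  | .pat u S, d => .pat u (close E S d)
  | .choice S S', d => .choice (close E S d) (close E S' d)
  | .mu S, d => .mu (close E S (d + 1))
  | .list I S τ, d => .list I (fun i => close E (S i) d) τ
  | .most S, d => .most (close E S d)
  | .ite S S', d => .ite (close E S d) (close E S' d)

/-- Unfolding a closure amounts to extending the environment. This lets `reach` recurse on the body
of a fixed point instead of unfolding it forever. -/
theorem inst_close (R : CE ar X) {E : ℕ → CE ar X} (hE : ∀ n, (E n).ClosedBelow 0) (S : CE ar X) :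
    ∀ d, inst R (close E S (d + 1)) d = close (push R E) S d := by
  induction S with
  | fail => intros; rfl
  | var n =>
    intro d
    simp only [close]
    rcases lt_trichotomy n d with h | rfl | h
    · rw [if_pos (by omega), if_pos h, inst, if_neg (by omega), if_neg (by omega)]
    · rw [if_pos (by omega), if_neg (by omega), inst, if_pos rfl, Nat.sub_self]
      rfl
    · obtain ⟨j, rfl⟩ : ∃ j, n = d + (j + 1) := ⟨n - d - 1, by omega⟩
      rw [if_neg (by omega), if_neg (by omega), Nat.add_sub_cancel_left,
        show d + (j + 1) - (d + 1) = j by omega]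
      exact ((hE j).mono (Nat.zero_le d)).inst_eq R
  | pat u S ih => intro d; simp only [close, inst, ih]
  | choice S S' ih ih' => intro d; simp only [close, inst, ih, ih']
  | ite S S' ih ih' => intro d; simp only [close, inst, ih, ih']
  | mu S ih => intro d; simp only [close, inst, ih]
  | list I S τ ih => intro d; simp only [close, inst, ih]
  | most S ih => intro d; simp only [close, inst, ih]

theorem close_eq (E : ℕ → CE ar X) {S : CE ar X} :
    ∀ {d}, S.ClosedBelow d → close E S d = S := by
  induction S with
  | fail => intros; rfl
  | var n => intro d h; exact if_pos h
  | pat u S ih => intro k h; simp only [close, ih (d := k) h]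
  | choice S S' ih ih' => intro k h; simp only [close, ih h.1, ih' h.2]
  | ite S S' ih ih' => intro k h; simp only [close, ih h.1, ih' h.2]
  | mu S ih => intro k h; simp only [close, ih (d := k + 1) h]
  | list I S τ ih => intro k h; simp only [close, fun i => ih i (h i)]
  | most S ih => intro k h; simp only [close, ih (d := k) h]

theorem closedBelow_close {E : ℕ → CE ar X} (hE : ∀ n, (E n).ClosedBelow 0) (S : CE ar X) :
    ∀ d, (close E S d).ClosedBelow d := by
  induction S with
  | fail => intros; trivial
  | var n =>
    intro d
    simp only [close]
    split_ifs with h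
    · exact h
    · exact (hE _).mono (Nat.zero_le _)
  | pat u S ih => intro d; exact ih d
  | choice S S' ih ih' => intro d; exact ⟨ih d, ih' d⟩
  | ite S S' ih ih' => intro d; exact ⟨ih d, ih' d⟩
  | mu S ih => intro d; exact ih (d + 1)
  | list I S τ ih => intro d i; exact ih i d
  | most S ih => intro d; exact ih d

/-- The strategies that the unification rules reach from a strategy in one step. -/
inductive Succ : CE ar X → CE ar X → Prop
  | pat {u S} : Succ (.pat u S) S
  | choiceL {S S'} : Succ (.choice S S') S
  | choiceR {S S'} : Succ (.choice S S') S'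
  | ite {S S'} : Succ (.ite S S') S'
  | list {I S τ} (i) : Succ (.list I S τ) (S i)
  | most {S} : Succ (.most S) S
  | mostList {S} : Succ (.most S) (.list (Finset.range (maxArity ar)) (fun _ => S) none)
  | mu {S} : Succ (.mu S) S.unfold

theorem Succ.closedBelow {S T : CE ar X} (h : Succ S T) (hS : S.ClosedBelow 0) :
    T.ClosedBelow 0 := by
  cases h with
  | pat => exact hS
  | choiceL => exact hS.1
  | choiceR => exact hS.2
  | ite => exact hS.2
  | list i => exact hS i
  | most => exact hS
  | mostList => exact fun _ => hS
  | mu => exact ClosedBelow.inst hS _ hS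

/-- A set of strategies that contains all strategies reachable from the closure of `S`
by `E`, outside those reachable from the values of `E`. -/
def reach : CE ar X → (ℕ → CE ar X) → Set (CE ar X)
  | .fail, _ => {.fail}
  | .var n, E => {E n}
  | .pat u S, E => insert (close E (.pat u S) 0) (reach S E)
  | .choice S S', E => insert (close E (.choice S S') 0) (reach S E ∪ reach S' E)
  | .mu S, E => insert (close E (.mu S) 0) (reach S (push (close E (.mu S) 0) E))
  | .list I S τ, E => insert (close E (.list I S τ) 0) (⋃ i, reach (S i) E)
  | .most S, E => insert (close E (.most S) 0) (insert
      (.list (Finset.range (maxArity ar)) (fun _ => close E S 0) none) (reach S E))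
  | .ite S S', E => insert (close E (.ite S S') 0) (reach S E ∪ reach S' E)

theorem finite_reach (S : CE ar X) : ∀ E, (reach S E).Finite := by
  induction S with
  | fail => intro E; exact Set.finite_singleton _
  | var n => intro E; exact Set.finite_singleton _
  | pat u S ih => intro E; exact (ih E).insert _
  | choice S S' ih ih' => intro E; exact ((ih E).union (ih' E)).insert _
  | ite S S' ih ih' => intro E; exact ((ih E).union (ih' E)).insert _
  | mu S ih => intro E; exact (ih _).insert _
  | list I S τ ih => intro E; exact (Set.finite_iUnion fun i => ih i E).insert _
  | most S ih => intro E; exact ((ih E).insert _).insert _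

theorem close_mem_reach (S : CE ar X) (E : ℕ → CE ar X) : close E S 0 ∈ reach S E := by
  cases S with
  | fail => exact Set.mem_singleton _
  | var n => exact Set.mem_singleton _
  | _ => exact Set.mem_insert _ _

/-- The values of `E` may have successors outside `reach S E`, hence the larger set `B`. Under `mu`
the new value of the environment is the fixed point itself, whose sole successor lies in the reach
of its body. -/
theorem mem_of_succ_of_mem_reach (S : CE ar X) : ∀ (E : ℕ → CE ar X) (B : Set (CE ar X))
    (_ : ∀ n, (E n).ClosedBelow 0) (_ : ∀ n T, Succ (E n) T → T ∈ B) (_ : reach S E ⊆ B),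
    ∀ T ∈ reach S E, ∀ T', Succ T T' → T' ∈ B := by
  induction S with
  | fail => rintro E B - - - _ rfl T' h; cases h
  | var n => rintro E B - hE - _ rfl T' h; exact hE n T' h
  | pat u S ih =>
    rintro E B hc hE hB T (rfl | hT) T' h
    · cases h
      exact hB (Or.inr (close_mem_reach _ _))
    · exact ih E B hc hE (fun _ h => hB (Or.inr h)) T hT T' h
  | choice S S' ih ih' =>
    rintro E B hc hE hB T (rfl | hT | hT) T' h
    · cases h
      · exact hB (Or.inr (Or.inl (close_mem_reach _ _)))
      · exact hB (Or.inr (Or.inr (close_mem_reach _ _)))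
    · exact ih E B hc hE (fun _ h => hB (Or.inr (Or.inl h))) T hT T' h
    · exact ih' E B hc hE (fun _ h => hB (Or.inr (Or.inr h))) T hT T' h
  | ite S S' ih ih' =>
    rintro E B hc hE hB T (rfl | hT | hT) T' h
    · cases h
      exact hB (Or.inr (Or.inr (close_mem_reach _ _)))
    · exact ih E B hc hE (fun _ h => hB (Or.inr (Or.inl h))) T hT T' h
    · exact ih' E B hc hE (fun _ h => hB (Or.inr (Or.inr h))) T hT T' h
  | mu S ih =>
    intro E B hc hE hB
    have hmu : ∀ T', Succ (close E (.mu S) 0) T' → T' ∈ B := by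
      intro T' h
      cases h
      refine hB (Or.inr ?_)
      rw [CE.unfold, inst_close _ hc]
      exact close_mem_reach _ _
    rintro T (rfl | hT) T' h
    · exact hmu T' h
    · refine ih _ B (fun n => ?_) (fun n => ?_) (fun _ h => hB (Or.inr h)) T hT T' h
      · cases n with
        | zero => exact closedBelow_close hc (.mu S) 0
        | succ n => exact hc n
      · cases n with
        | zero => exact hmu
        | succ n => exact hE n
  | list I S τ ih =>
    rintro E B hc hE hB T (rfl | hT) T' h
    · cases h with
      | list i => exact hB (Or.inr (Set.mem_iUnion.2 ⟨i, close_mem_reach _ _⟩))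
    · obtain ⟨i, hi⟩ := Set.mem_iUnion.1 hT
      exact ih i E B hc hE (fun _ h => hB (Or.inr (Set.mem_iUnion.2 ⟨i, h⟩))) T hi T' h
  | most S ih =>
    rintro E B hc hE hB T (rfl | rfl | hT) T' h
    · cases h
      · exact hB (Or.inr (Or.inr (close_mem_reach _ _)))
      · exact hB (Or.inr (Or.inl rfl))
    · cases h with
      | list i => exact hB (Or.inr (Or.inr (close_mem_reach _ _)))
    · exact ih E B hc hE (fun _ h => hB (Or.inr (Or.inr h))) T hT T' h

/-- From a closed strategy only finitely many strategies are reachable, and they are closed. -/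
theorem exists_finset_succ_closed (S : CE ar X) (hS : S.ClosedBelow 0) :
    ∃ B : Finset (CE ar X), S ∈ B ∧ (∀ T ∈ B, T.ClosedBelow 0) ∧
      ∀ T ∈ B, ∀ T', Succ T T' → T' ∈ B := by
  -- As `S` is closed, any environment would do; `fail` is chosen because it has no successors.
  have hfin : {T ∈ reach S fun _ => .fail | T.ClosedBelow 0}.Finite :=
    (finite_reach S _).subset (Set.sep_subset _ _)
  refine ⟨hfin.toFinset, ?_, fun T hT => ?_, fun T hT T' h => ?_⟩
  · refine hfin.mem_toFinset.2 ⟨?_, hS⟩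
    have := close_mem_reach S fun _ => .fail
    rwa [close_eq _ hS] at this
  · exact (hfin.mem_toFinset.1 hT).2
  · obtain ⟨hT, hcl⟩ := hfin.mem_toFinset.1 hT
    exact hfin.mem_toFinset.2 ⟨mem_of_succ_of_mem_reach S (fun _ => .fail) _ (fun _ => trivial)
      (fun _ _ h => by cases h) subset_rfl T hT T' h, h.closedBelow hcl⟩

end CE

end CES

/-! ### Unification preserves admissibility and merges plans -/

namespace CES

namespace CE

variable {F : Type*} {ar : F → ℕ} {X : Type*} {m : Ctx ar X → Ctx ar X → Ctx ar X}

/-- Each unfolding adds one memory entry and one binder, so the free variables of the result are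
indices into the memory. -/
theorem Unif.closedBelow {M : List (CE ar X × CE ar X)} {S S' R : CE ar X} (h : Unif m M S S' R)
    (hS : S.ClosedBelow 0) (hS' : S'.ClosedBelow 0) : R.ClosedBelow M.length := by
  induction h with
  | failL => trivial
  | failR => trivial
  | insertion c d => exact fun i => absurd i.2 (Finset.notMem_empty _)
  | patL _ _ ih => exact ih hS hS'
  | patR _ _ ih => exact ih hS hS'
  | jump i S S' R h ih => exact fun j => ih (hS ⟨i, by simp⟩) (hS' ⟨i, by simp⟩)
  | @list M I J S S' τ τ' R _ _ _ ih =>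
    have h1 : (CE.list I S τ).ClosedBelow M.length := hS.mono (Nat.zero_le _)
    have h2 : (CE.list J S' τ').ClosedBelow M.length := hS'.mono (Nat.zero_le _)
    refine ⟨h1, h2, fun i => ?_⟩
    unfold mergeList
    split_ifs with hi hj
    · exact ⟨ih _ (hS _) (hS' _), h1 _, h2 _⟩
    · exact h1 _
    · exact h2 _
  | choiceL _ _ _ ih₁ ih₂ => exact ⟨ih₁ hS.1 hS', ih₂ hS.2 hS'⟩
  | choiceR _ _ _ ih₁ ih₂ => exact ⟨ih₁ hS hS'.1, ih₂ hS hS'.2⟩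
  | iteL _ _ ih => exact ⟨hS.1.mono (Nat.zero_le _), ih hS.2 hS'⟩
  | iteR _ _ ih => exact ⟨hS'.1.mono (Nat.zero_le _), ih hS hS'.2⟩
  | most _ ih =>
    exact ⟨hS.mono (Nat.zero_le _), hS'.mono (Nat.zero_le _), ih hS hS',
      ClosedBelow.mono hS (Nat.zero_le _), ClosedBelow.mono hS' (Nat.zero_le _)⟩
  | mostL _ ih => exact ih (fun _ => hS) hS'
  | mostR _ ih => exact ih hS fun _ => hS'
  | muL _ _ _ ih => exact ih (ClosedBelow.inst hS _ hS) hS'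
  | muLVar n _ hM => exact (List.getElem?_eq_some_iff.1 hM).1
  | muR _ _ _ ih => exact ih hS (ClosedBelow.inst hS' _ hS')
  | muRVar n _ hM => exact (List.getElem?_eq_some_iff.1 hM).1

/-- The variable of a pair in the memory is guarded in the result when the pair has a larger
head depth than the current one. -/
theorem Unif.guarded {M : List (CE ar X × CE ar X)} {S S' R : CE ar X} (h : Unif m M S S' R)
    (hS : S.Admissible) (hS' : S'.Admissible) {n : ℕ} {p : CE ar X × CE ar X}
    (hp : M[n]? = some p)
    (hlt : S.headDepth + S'.headDepth < p.1.headDepth + p.2.headDepth) : R.Guarded n := by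
  induction h generalizing n with
  | failL => trivial
  | failR => trivial
  | insertion c d => trivial
  | patL _ _ ih => exact ih hS hS' hp (by simp only [headDepth] at hlt; omega)
  | patR _ _ ih => exact ih hS hS' hp (by simp only [headDepth] at hlt; omega)
  | jump i S S' R h ih => trivial
  | list R _ _ _ ih => exact ⟨trivial, trivial, trivial⟩
  | choiceL _ _ _ ih₁ ih₂ =>
    simp only [headDepth] at hlt
    exact ⟨ih₁ ⟨hS.1.1, hS.2.1⟩ hS' hp (by omega), ih₂ ⟨hS.1.2, hS.2.2⟩ hS' hp (by omega)⟩
  | choiceR _ _ _ ih₁ ih₂ =>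
    simp only [headDepth] at hlt
    exact ⟨ih₁ hS ⟨hS'.1.1, hS'.2.1⟩ hp (by omega), ih₂ hS ⟨hS'.1.2, hS'.2.2⟩ hp (by omega)⟩
  | iteL _ _ ih =>
    simp only [headDepth] at hlt
    exact ⟨hS.1.1.guarded (Nat.zero_le _), ih ⟨hS.1.2, hS.2.2⟩ hS' hp (by omega)⟩
  | iteR _ _ ih =>
    simp only [headDepth] at hlt
    exact ⟨hS'.1.1.guarded (Nat.zero_le _), ih hS ⟨hS'.1.2, hS'.2.2⟩ hp (by omega)⟩
  | most _ ih => exact ⟨trivial, trivial, trivial⟩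
  | mostL _ ih => exact ih ⟨fun _ => hS.1, fun _ => hS.2⟩ hS' hp hlt
  | mostR _ ih => exact ih hS ⟨fun _ => hS'.1, fun _ => hS'.2⟩ hp hlt
  | @muL M S S' R _ _ _ ih =>
    have := headDepth_unfold_lt hS.2.1
    exact ih (n := n + 1) hS.unfold hS' hp (by omega)
  | @muR M S S' R _ _ _ ih =>
    have := headDepth_unfold_lt hS'.2.1
    exact ih (n := n + 1) hS hS'.unfold hp (by omega)
  | muLVar k _ hM =>
    -- If the emitted variable were `n`, the `n`-th pair would be the current pair, against the
    -- strict inequality.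
    rintro rfl
    rw [hM] at hp
    cases hp
    exact lt_irrefl _ hlt
  | muRVar k _ hM =>
    rintro rfl
    rw [hM] at hp
    cases hp
    exact lt_irrefl _ hlt

/-- Index `0` carries the pair just stored, whose head depth exceeds that of the unfolded pair. -/
theorem Unif.guarded_muL {M : List (CE ar X × CE ar X)} {S S' R : CE ar X}
    (h : Unif m ((CE.mu S, S') :: M) S.unfold S' R) (hS : (CE.mu S).Admissible)
    (hS' : S'.Admissible) : R.Guarded 0 :=
  h.guarded hS.unfold hS' (p := (CE.mu S, S')) rfl
    (Nat.add_lt_add_right (headDepth_unfold_lt hS.2.1) _)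

theorem Unif.guarded_muR {M : List (CE ar X × CE ar X)} {S S' R : CE ar X}
    (h : Unif m ((S, CE.mu S') :: M) S S'.unfold R) (hS : S.Admissible)
    (hS' : (CE.mu S').Admissible) : R.Guarded 0 :=
  h.guarded hS hS'.unfold (p := (S, CE.mu S')) rfl
    (Nat.add_lt_add_left (headDepth_unfold_lt hS'.2.1) _)

theorem Unif.monotone {M : List (CE ar X × CE ar X)} {S S' R : CE ar X} (h : Unif m M S S' R)
    (hS : S.Admissible) (hS' : S'.Admissible) : R.Monotone := by
  induction h with
  | failL => trivial
  | failR => trivial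
  | insertion c d => exact fun i => absurd i.2 (Finset.notMem_empty _)
  | patL _ _ ih => exact ih hS hS'
  | patR _ _ ih => exact ih hS hS'
  | jump i S S' R h ih =>
    exact fun j => ih ⟨hS.1 ⟨i, by simp⟩, hS.2 ⟨i, by simp⟩⟩ ⟨hS'.1 ⟨i, by simp⟩, hS'.2 ⟨i, by simp⟩⟩
  | list R _ _ _ ih =>
    refine ⟨hS.2, hS'.2, fun i => ?_⟩
    unfold mergeList
    split_ifs with hi hj
    · exact ⟨ih _ ⟨hS.1 _, hS.2 _⟩ ⟨hS'.1 _, hS'.2 _⟩, hS.2 _, hS'.2 _⟩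
    · exact hS.2 _
    · exact hS'.2 _
  | choiceL _ _ _ ih₁ ih₂ => exact ⟨ih₁ ⟨hS.1.1, hS.2.1⟩ hS', ih₂ ⟨hS.1.2, hS.2.2⟩ hS'⟩
  | choiceR _ _ _ ih₁ ih₂ => exact ⟨ih₁ hS ⟨hS'.1.1, hS'.2.1⟩, ih₂ hS ⟨hS'.1.2, hS'.2.2⟩⟩
  | iteL _ _ ih => exact ⟨hS.2.1, ih ⟨hS.1.2, hS.2.2⟩ hS'⟩
  | iteR _ _ ih => exact ⟨hS'.2.1, ih hS ⟨hS'.1.2, hS'.2.2⟩⟩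
  | most _ ih => exact ⟨hS.2, hS'.2, ih hS hS', hS.2, hS'.2⟩
  | mostL _ ih => exact ih ⟨fun _ => hS.1, fun _ => hS.2⟩ hS'
  | mostR _ ih => exact ih hS ⟨fun _ => hS'.1, fun _ => hS'.2⟩
  | muL _ _ h ih => exact ⟨h.guarded_muL hS hS', ih hS.unfold hS'⟩
  | muR _ _ h ih => exact ⟨h.guarded_muR hS hS', ih hS hS'.unfold⟩
  | muLVar k _ hM => trivial
  | muRVar k _ hM => trivial

/-- Bounded arity is essential: it makes the supremum `maxArity` an actual bound, so the list
reaches every child. -/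
theorem closedPlan_most_eq_list (har : BddAbove (Set.range ar)) (S : CE ar X) :
    (CE.most S).closedPlan =
      (CE.list (Finset.range (maxArity ar)) (fun _ => S) none).closedPlan := by
  funext t
  simp only [closedPlan, plan]
  congr 1
  funext i
  split_ifs with hi
  · rfl
  · cases t with
    | var x => rfl
    | app f ts =>
      have hle : ar f ≤ maxArity ar := le_ciSup har f
      have : ¬ i < ar f := fun h => hi (Finset.mem_range.2 (h.trans_le hle))
      simp [Term.child?, this]

theorem mergeOpt_eq (τ τ' : Option (Ctx ar X)) : mergeOpt m τ τ' = Option.merge m τ τ' := by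
  cases τ <;> cases τ' <;> rfl

/-- The plan of the result merges the plans of the two strategies and fails where one of them
fails. -/
theorem Unif.plan_eq (har : BddAbove (Set.range ar)) {M : List (CE ar X × CE ar X)}
    {S S' R : CE ar X} (h : Unif m M S S' R) (hS : S.Admissible) (hS' : S'.Admissible)
    (ρ : ℕ → Term ar X → Option (Plan ar X))
    (hρ : ∀ n p, M[n]? = some p →
      ∀ t, ρ n t = Option.map₂ (Plan.merge m) (p.1.closedPlan t) (p.2.closedPlan t))
    (t : Term ar X) :
    R.plan ρ t = Option.map₂ (Plan.merge m) (S.closedPlan t) (S'.closedPlan t) := by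
  induction h generalizing ρ t with
  | failL => simp [plan, closedPlan]
  | failR => simp [plan, closedPlan]
  | insertion c d =>
    simp [plan, closedPlan, CE.insertion, Plan.tryNode, Plan.merge_node]
  | patL _ _ ih =>
    simp only [plan, closedPlan]
    split_ifs
    · exact ih hS hS' ρ hρ t
    · simp
  | patR _ _ ih =>
    simp only [plan, closedPlan]
    split_ifs
    · exact ih hS hS' ρ hρ t
    · simp
  | jump i S S' R h ih =>
    have ih := ih ⟨hS.1 ⟨i, by simp⟩, hS.2 ⟨i, by simp⟩⟩ ⟨hS'.1 ⟨i, by simp⟩, hS'.2 ⟨i, by simp⟩⟩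
      ρ hρ
    simp only [closedPlan] at ih
    simp only [closedPlan, plan, Finset.mem_singleton, dite_eq_ite, Plan.tryNode_child]
    cases t.child? i with
    | none => rfl
    | some s =>
      simp only [Option.bind_some, ih s]
      cases S.plan (fun _ _ => none) s <;> cases S'.plan (fun _ _ => none) s <;>
        simp [Plan.merge_single]
  | @list M I J S S' τ τ' R _ _ _ ih =>
    have h1 := congrFun (plan_eq_closedPlan hS.1 ρ) t
    have h2 := congrFun (plan_eq_closedPlan hS'.1 ρ) t
    rw [plan_ite, plan_ite, h1, h2, plan]
    simp only [closedPlan, plan, Plan.map₂_tryNode, mergeOpt_eq]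
    congr 1
    funext _
    congr 1
    funext _
    congr 1
    funext i
    simp only [Finset.mem_union]
    cases t.child? i with
    | none => simp
    | some s =>
      simp only [Option.bind_some]
      by_cases hi : i ∈ I <;> by_cases hj : i ∈ J
      · have := ih ⟨i, Finset.mem_inter.2 ⟨hi, hj⟩⟩ ⟨hS.1 _, hS.2 _⟩ ⟨hS'.1 _, hS'.2 _⟩ ρ hρ s
        simp only [hi, hj, true_or, dite_true, mergeList, plan, this,
          plan_eq_closedPlan (hS.1 ⟨i, hi⟩) ρ, plan_eq_closedPlan (hS'.1 ⟨i, hj⟩) ρ,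
          Plan.map₂_or_or]
        rfl
      · simp only [hi, hj, true_or, dite_true, dite_false, mergeList,
          plan_eq_closedPlan (hS.1 ⟨i, hi⟩) ρ, Option.merge_none_right]
        rfl
      · simp only [hi, hj, or_true, dite_true, dite_false, mergeList,
          plan_eq_closedPlan (hS'.1 ⟨i, hj⟩) ρ, Option.merge_none_left]
        rfl
      · simp [hi, hj]
  | @choiceL _ S₁ S₂ S' _ _ _ _ _ ih₁ ih₂ =>
    rw [plan, ih₁ ⟨hS.1.1, hS.2.1⟩ hS' ρ hρ t, ih₂ ⟨hS.1.2, hS.2.2⟩ hS' ρ hρ t]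
    simp only [closedPlan, plan]
    -- If `S'` fails, both branches fail; otherwise the branch is selected by `S₁` alone, so merging
    -- distributes over the choice.
    cases S₁.plan (fun _ _ => none) t <;> cases S'.plan (fun _ _ => none) t <;> simp
  | @choiceR _ S S₁ S₂ _ _ _ _ _ ih₁ ih₂ =>
    rw [plan, ih₁ hS ⟨hS'.1.1, hS'.2.1⟩ ρ hρ t, ih₂ hS ⟨hS'.1.2, hS'.2.2⟩ ρ hρ t]
    simp only [closedPlan, plan]
    cases S₁.plan (fun _ _ => none) t <;> cases S.plan (fun _ _ => none) t <;> simp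
  | @iteL _ S₁ S₂ S' _ _ _ ih =>
    rw [plan, ih ⟨hS.1.2, hS.2.2⟩ hS' ρ hρ t, plan_eq_closedPlan hS.1.1 ρ]
    simp only [closedPlan, plan]
    cases S₁.plan (fun _ _ => none) t <;> simp
  | @iteR _ S S₁ S₂ _ _ _ ih =>
    rw [plan, ih hS ⟨hS'.1.2, hS'.2.2⟩ ρ hρ t, plan_eq_closedPlan hS'.1.1 ρ]
    simp only [closedPlan, plan]
    cases S₁.plan (fun _ _ => none) t <;> simp
  | @most M S S' R _ ih =>
    have h1 := congrFun (plan_eq_closedPlan hS.1 ρ) t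
    have h2 := congrFun (plan_eq_closedPlan hS'.1 ρ) t
    have h3 : S.plan ρ = S.closedPlan := plan_eq_closedPlan (S := S) hS.1 ρ
    have h4 : S'.plan ρ = S'.closedPlan := plan_eq_closedPlan (S := S') hS'.1 ρ
    rw [plan_ite, plan_ite, h1, h2, plan]
    simp only [plan, h3, h4, ih hS hS' ρ hρ, Plan.map₂_or_or]
    simp only [closedPlan, plan, Plan.map₂_tryNode]
    congr 1
    funext _
    congr 1
    funext _
    congr 1
    funext i
    cases t.child? i <;> rfl
  | mostL _ ih =>
    rw [closedPlan_most_eq_list har]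
    exact ih ⟨fun _ => hS.1, fun _ => hS.2⟩ hS' ρ hρ t
  | mostR _ ih =>
    rw [closedPlan_most_eq_list har]
    exact ih hS ⟨fun _ => hS'.1, fun _ => hS'.2⟩ ρ hρ t
  | @muL M S S' R _ _ h ih =>
    -- By uniqueness of the fixed point it suffices that the merged plans solve the equation of the
    -- new binder: reading the new variable as this merge, the induction hypothesis applies to the
    -- unfolding, which has the same plan as the fixed point.
    refine plan_mu_eq_of_fixed (h.guarded_muL hS hS')
      (g := fun t => Option.map₂ (Plan.merge m) ((CE.mu S).closedPlan t) (S'.closedPlan t)) ?_ t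
    intro t
    rw [ih hS.unfold hS' _ ?_ t, closedPlan_unfold hS]
    rintro (_ | n) p hp t
    · cases hp; rfl
    · exact hρ n p hp t
  | @muR M S S' R _ _ h ih =>
    refine plan_mu_eq_of_fixed (h.guarded_muR hS hS')
      (g := fun t => Option.map₂ (Plan.merge m) (S.closedPlan t) ((CE.mu S').closedPlan t)) ?_ t
    intro t
    rw [ih hS hS'.unfold _ ?_ t, closedPlan_unfold hS']
    rintro (_ | n) p hp t
    · cases hp; rfl
    · exact hρ n p hp t
  | muLVar k _ hM => exact hρ k _ hM t
  | muRVar k _ hM => exact hρ k _ hM t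

end CE

end CES

/-! ### Existence of normal forms -/

namespace CES

namespace CE

variable {F : Type*} {ar : F → ℕ} {X : Type*} {m : Ctx ar X → Ctx ar X → Ctx ar X}

/-- A measure that decreases along the unification rules other than unfolding. -/
def weight : CE ar X → ℕ
  | .fail => 0
  | .var _ => 0
  | .pat _ S => S.weight + 1
  | .choice S S' => max S.weight S'.weight + 1
  | .mu _ => 0
  | .list _ S _ => (Finset.univ.sup fun i => (S i).weight) + 1
  | .most S => S.weight + 2
  | .ite _ S' => S'.weight + 1

theorem weight_lt_weight_list {I : Finset ℕ} (S : {i : ℕ // i ∈ I} → CE ar X)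
    (τ : Option (Ctx ar X)) (i) : (S i).weight < (CE.list I S τ).weight :=
  Nat.lt_succ_of_le (Finset.le_sup (f := fun i => (S i).weight) (Finset.mem_univ i))

/-- Replacing `most` by a list must lower the weight; hence the summand `2` for `most` against `1`
for a list. -/
theorem weight_list_const_lt (I : Finset ℕ) (S : CE ar X) (τ : Option (Ctx ar X)) :
    (CE.list I (fun _ => S) τ).weight < (CE.most S).weight :=
  Nat.succ_lt_succ (Nat.lt_succ_of_le (Finset.sup_le fun _ _ => le_rfl))

theorem exists_unif_list {M : List (CE ar X × CE ar X)} {I J : Finset ℕ}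
    (S : {i : ℕ // i ∈ I} → CE ar X) (S' : {i : ℕ // i ∈ J} → CE ar X)
    (τ τ' : Option (Ctx ar X)) (h : ∀ i j, ∃ R, Unif m M (S i) (S' j) R) :
    ∃ R, Unif m M (.list I S τ) (.list J S' τ') R := by
  by_cases hins : I = ∅ ∧ J = ∅ ∧ τ ≠ none ∧ τ' ≠ none
  · obtain ⟨rfl, rfl, hτ, hτ'⟩ := hins
    obtain ⟨c, rfl⟩ := Option.ne_none_iff_exists'.1 hτ
    obtain ⟨d, rfl⟩ := Option.ne_none_iff_exists'.1 hτ'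
    -- All families over the empty index set are equal, so these lists are literally insertions.
    rw [show CE.list ∅ S (some c) = .insertion c from congrArg (CE.list ∅ · _) (Subsingleton.elim _ _),
      show CE.list ∅ S' (some d) = .insertion d from congrArg (CE.list ∅ · _) (Subsingleton.elim _ _)]
    exact ⟨_, .insertion c d⟩
  · by_cases hjump : I = J ∧ I.card = 1 ∧ τ = none ∧ τ' = none
    · obtain ⟨rfl, hI, rfl, rfl⟩ := hjump
      obtain ⟨i, rfl⟩ := Finset.card_eq_one.1 hI
      obtain ⟨R, hR⟩ := h ⟨i, by simp⟩ ⟨i, by simp⟩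
      have hS : ∀ S : {j : ℕ // j ∈ ({i} : Finset ℕ)} → CE ar X,
          S = fun _ => S ⟨i, by simp⟩ := by
        intro S
        funext j
        congr 1
        exact Subtype.ext (Finset.mem_singleton.1 j.2)
      rw [hS S, hS S']
      exact ⟨_, .jump i _ _ R hR⟩
    · choose R hR using h
      exact ⟨_, .list (fun i => R ⟨i.1, _⟩ ⟨i.1, _⟩) hins hjump fun i => hR _ _⟩

theorem rank_pos {S : CE ar X} (h : S ≠ .fail) : 0 < S.rank := by
  cases S <;> simp_all [rank]

theorem one_lt_rank {S : CE ar X} (h : 0 < S.rank) (h' : ¬ ∃ u T, S = .pat u T) :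
    1 < S.rank := by
  cases S <;> simp_all [rank]

theorem two_lt_rank {S : CE ar X} (h : 1 < S.rank) (h' : ¬ ∃ T U, S = .choice T U) :
    2 < S.rank := by
  cases S <;> simp_all [rank]

theorem three_lt_rank {S : CE ar X} (h : 2 < S.rank) (h' : ¬ ∃ T U, S = .ite T U) :
    3 < S.rank := by
  cases S <;> simp_all [rank]

/-- Closedness excludes a bare variable, the one head for which no rule is available. -/
theorem rank_eq_four {S : CE ar X} (h : 3 < S.rank) (h' : ¬ ∃ T, S = .mu T)
    (hS : S.ClosedBelow 0) : S.rank = 4 := by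
  cases S <;> simp_all [rank, ClosedBelow]

/-- Lexicographic induction: `k` bounds the number of pairs of `B ×ˢ B` not yet in the memory and
drops at each unfolding; `w` bounds the total weight and drops at every other rule that recurses. -/
theorem exists_unif_of_succ_closed (B : Finset (CE ar X)) (hB : ∀ T ∈ B, T.ClosedBelow 0)
    (hsucc : ∀ T ∈ B, ∀ T', Succ T T' → T' ∈ B) (k : ℕ) :
    ∀ (M : List (CE ar X × CE ar X)), (∀ p ∈ M, p ∈ B ×ˢ B) → M.Nodup →
      B.card * B.card ≤ M.length + k →
    ∀ (w : ℕ) (S S' : CE ar X), S ∈ B → S' ∈ B → S.weight + S'.weight ≤ w →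
      ∃ R, Unif m M S S' R := by
  classical
  have hlen : ∀ M : List (CE ar X × CE ar X), (∀ p ∈ M, p ∈ B ×ˢ B) → M.Nodup →
      M.length ≤ B.card * B.card := by
    intro M hMB hM
    rw [← Finset.card_product, ← List.toFinset_card_of_nodup hM]
    exact Finset.card_le_card fun p hp => hMB p (List.mem_toFinset.1 hp)
  induction k using Nat.strong_induction_on with
  | _ k ih =>
  intro M hMB hM hk w
  have push : ∀ p ∈ B ×ˢ B, p ∉ M → ∃ l < k, B.card * B.card ≤ (p :: M).length + l ∧
      (∀ q ∈ p :: M, q ∈ B ×ˢ B) ∧ (p :: M).Nodup := by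
    intro p hp hpM
    have h1 : ∀ q ∈ p :: M, q ∈ B ×ˢ B := by
      intro q hq
      rcases List.mem_cons.1 hq with rfl | hq
      · exact hp
      · exact hMB q hq
    have h2 : (p :: M).Nodup := List.nodup_cons.2 ⟨hpM, hM⟩
    have h3 := hlen _ h1 h2
    rw [List.length_cons] at h3
    -- The enlarged memory still fits into `B ×ˢ B`, which forces `k` to be positive.
    exact ⟨k - 1, by omega, by rw [List.length_cons]; omega, h1, h2⟩
  induction w using Nat.strong_induction_on with
  | _ w ihw =>
  intro S S' hS hS' hw
  have step : ∀ T T', T ∈ B → T' ∈ B → T.weight + T'.weight < S.weight + S'.weight →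
      ∃ R, Unif m M T T' R := fun T T' h h' hlt => ihw _ (hlt.trans_le hw) T T' h h' le_rfl
  by_cases h0 : S = .fail
  · exact h0 ▸ ⟨_, .failL⟩
  by_cases h0' : S' = .fail
  · exact h0' ▸ ⟨_, .failR⟩
  by_cases h1 : ∃ u T, S = .pat u T
  · obtain ⟨u, T, rfl⟩ := h1
    obtain ⟨R, hR⟩ := step T S' (hsucc _ hS _ .pat) hS' (by simp only [weight]; omega)
    exact ⟨_, .patL (rank_pos h0') hR⟩
  have hr := one_lt_rank (rank_pos h0) h1
  by_cases h1' : ∃ u T, S' = .pat u T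
  · obtain ⟨u, T, rfl⟩ := h1'
    obtain ⟨R, hR⟩ := step S T hS (hsucc _ hS' _ .pat) (by simp only [weight]; omega)
    exact ⟨_, .patR hr hR⟩
  have hr' := one_lt_rank (rank_pos h0') h1'
  by_cases h2 : ∃ T U, S = .choice T U
  · obtain ⟨T, U, rfl⟩ := h2
    obtain ⟨R, hR⟩ := step T S' (hsucc _ hS _ .choiceL) hS' (by simp only [weight]; omega)
    obtain ⟨Q, hQ⟩ := step U S' (hsucc _ hS _ .choiceR) hS' (by simp only [weight]; omega)
    exact ⟨_, .choiceL hr' hR hQ⟩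
  replace hr := two_lt_rank hr h2
  by_cases h2' : ∃ T U, S' = .choice T U
  · obtain ⟨T, U, rfl⟩ := h2'
    obtain ⟨R, hR⟩ := step S T hS (hsucc _ hS' _ .choiceL) (by simp only [weight]; omega)
    obtain ⟨Q, hQ⟩ := step S U hS (hsucc _ hS' _ .choiceR) (by simp only [weight]; omega)
    exact ⟨_, .choiceR hr hR hQ⟩
  replace hr' := two_lt_rank hr' h2'
  by_cases h3 : ∃ T U, S = .ite T U
  · obtain ⟨T, U, rfl⟩ := h3
    obtain ⟨R, hR⟩ := step U S' (hsucc _ hS _ .ite) hS' (by simp only [weight]; omega)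
    exact ⟨_, .iteL hr' hR⟩
  replace hr := three_lt_rank hr h3
  by_cases h3' : ∃ T U, S' = .ite T U
  · obtain ⟨T, U, rfl⟩ := h3'
    obtain ⟨R, hR⟩ := step S U hS (hsucc _ hS' _ .ite) (by simp only [weight]; omega)
    exact ⟨_, .iteR hr hR⟩
  replace hr' := three_lt_rank hr' h3'
  by_cases h4 : ∃ T, S = .mu T
  · obtain ⟨T, rfl⟩ := h4
    by_cases hmem : (CE.mu T, S') ∈ M
    · obtain ⟨n, hn⟩ := List.mem_iff_getElem?.1 hmem
      exact ⟨_, .muLVar n hr' hn⟩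
    · obtain ⟨l, hl, hcard, hmem', hnd⟩ := push _ (Finset.mk_mem_product hS hS') hmem
      obtain ⟨R, hR⟩ := ih l hl _ hmem' hnd hcard _ _ _ (hsucc _ hS _ .mu) hS' le_rfl
      exact ⟨_, .muL hr' hmem hR⟩
  have hr4 := rank_eq_four hr h4 (hB _ hS)
  by_cases h4' : ∃ T, S' = .mu T
  · obtain ⟨T, rfl⟩ := h4'
    by_cases hmem : (S, CE.mu T) ∈ M
    · obtain ⟨n, hn⟩ := List.mem_iff_getElem?.1 hmem
      exact ⟨_, .muRVar n hr4 hn⟩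
    · obtain ⟨l, hl, hcard, hmem', hnd⟩ := push _ (Finset.mk_mem_product hS hS') hmem
      obtain ⟨R, hR⟩ := ih l hl _ hmem' hnd hcard _ _ _ hS (hsucc _ hS' _ .mu) le_rfl
      exact ⟨_, .muR hr4 hmem hR⟩
  have hr4' := rank_eq_four hr' h4' (hB _ hS')
  -- Rank four leaves only lists and `most` on each side.
  cases S <;> simp only [rank, reduceCtorEq, Nat.reduceEqDiff] at hr4 <;>
    cases S' <;> simp only [rank, reduceCtorEq, Nat.reduceEqDiff] at hr4'
  case list.list I T τ J T' τ' =>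
    exact exists_unif_list T T' τ τ' fun i j => step _ _ (hsucc _ hS _ (.list i))
      (hsucc _ hS' _ (.list j))
      (add_lt_add (weight_lt_weight_list T τ i) (weight_lt_weight_list T' τ' j))
  case list.most I T τ T' =>
    obtain ⟨R, hR⟩ := step _ _ hS (hsucc _ hS' _ .mostList)
      (Nat.add_lt_add_left (weight_list_const_lt _ T' none) _)
    exact ⟨_, .mostR hR⟩
  case most.list T J T' τ' =>
    obtain ⟨R, hR⟩ := step _ _ (hsucc _ hS _ .mostList) hS'
      (Nat.add_lt_add_right (weight_list_const_lt _ T none) _)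
    exact ⟨_, .mostL hR⟩
  case most.most T T' =>
    obtain ⟨R, hR⟩ := step T T' (hsucc _ hS _ .most) (hsucc _ hS' _ .most)
      (by simp only [weight]; omega)
    exact ⟨_, .most hR⟩

theorem exists_unif {S S' : CE ar X} (hS : S.ClosedBelow 0) (hS' : S'.ClosedBelow 0) :
    ∃ R, Unif m [] S S' R := by
  classical
  obtain ⟨B, h1, h2, h3⟩ := exists_finset_succ_closed S hS
  obtain ⟨B', h1', h2', h3'⟩ := exists_finset_succ_closed S' hS'
  refine exists_unif_of_succ_closed (B ∪ B') (fun T hT => ?_) (fun T hT T' h => ?_) _ []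
    (by simp) (by simp) le_add_self _ S S' (by simp [h1]) (by simp [h1']) le_rfl
  · exact (Finset.mem_union.1 hT).elim (h2 T) (h2' T)
  · exact Finset.mem_union.2 ((Finset.mem_union.1 hT).imp (h3 T · T' h) (h3' T · T' h))

/-! ### Uniqueness of normal forms -/

/-- The reduction rules are deterministic. -/
theorem Unif.unique {M : List (CE ar X × CE ar X)} {S S' R R' : CE ar X} (h : Unif m M S S' R)
    (h' : Unif m M S S' R') (hM : M.Nodup) : R = R' := by
  induction h generalizing R' with
  -- In each case the composite indices are first named, so that `cases` can split the second
  -- derivation; competing rules are then refuted by head constructors, ranks, memory or list shape.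
  | failL =>
    generalize hA : CE.fail = A at h'
    cases h' <;> cases hA <;> simp_all [rank]
  | failR =>
    generalize hA : CE.fail = A at h'
    cases h' <;> cases hA <;> simp_all [rank]
  | patL hp h ih =>
    generalize hA : CE.pat _ _ = A at h'
    cases h' <;> cases hA <;> first
      | exact congrArg _ (ih (by assumption) hM)
      | (exfalso; simp_all [rank])
  | patR hp h ih =>
    generalize hA : CE.pat _ _ = A at h'
    cases h' <;> cases hA <;> first
      | exact congrArg _ (ih (by assumption) hM)
      | (exfalso; simp_all [rank])
  | iteL hp h ih =>
    generalize hA : CE.ite _ _ = A at h'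
    cases h' <;> cases hA <;> first
      | exact congrArg _ (ih (by assumption) hM)
      | (exfalso; simp_all [rank])
  | iteR hp h ih =>
    generalize hA : CE.ite _ _ = A at h'
    cases h' <;> cases hA <;> first
      | exact congrArg _ (ih (by assumption) hM)
      | (exfalso; simp_all [rank])
  | choiceL hp h₁ h₂ ih₁ ih₂ =>
    generalize hA : CE.choice _ _ = A at h'
    cases h' <;> cases hA <;> first
      | exact congrArg₂ _ (ih₁ (by assumption) hM) (ih₂ (by assumption) hM)
      | (exfalso; simp_all [rank])
  | choiceR hp h₁ h₂ ih₁ ih₂ =>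
    generalize hA : CE.choice _ _ = A at h'
    cases h' <;> cases hA <;> first
      | exact congrArg₂ _ (ih₁ (by assumption) hM) (ih₂ (by assumption) hM)
      | (exfalso; simp_all [rank])
  | most h ih =>
    generalize hA : CE.most _ = A at h'
    generalize hB : CE.most _ = B at h'
    cases h' <;> cases hA <;> cases hB
    rw [ih (by assumption) hM]
  | mostL h ih =>
    generalize hA : CE.most _ = A at h'
    generalize hB : CE.list _ _ _ = B at h'
    cases h' <;> cases hA <;> cases hB
    exact ih (by assumption) hM
  | mostR h ih =>
    generalize hA : CE.most _ = A at h'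
    generalize hB : CE.list _ _ _ = B at h'
    cases h' <;> cases hA <;> cases hB
    exact ih (by assumption) hM
  | muL hp hm h ih =>
    generalize hA : CE.mu _ = A at h'
    cases h' <;> cases hA <;> first
      | exact congrArg _ (ih (by assumption) (List.nodup_cons.2 ⟨hm, hM⟩))
      | exact absurd (List.mem_of_getElem? (by assumption)) hm
      | (exfalso; simp_all [rank])
  | muR hp hm h ih =>
    generalize hA : CE.mu _ = A at h'
    cases h' <;> cases hA <;> first
      | exact congrArg _ (ih (by assumption) (List.nodup_cons.2 ⟨hm, hM⟩))
      | exact absurd (List.mem_of_getElem? (by assumption)) hm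
      | (exfalso; simp_all [rank])
  | muLVar n hp hm =>
    generalize hA : CE.mu _ = A at h'
    cases h' <;> cases hA <;> first
      -- A memory without repetitions holds the pair at one index only, so the variable is
      -- determined.
      | exact congrArg CE.var ((List.getElem?_inj (List.getElem?_eq_some_iff.1 hm).1 hM).1
          (hm.trans (Eq.symm (by assumption))))
      | exact absurd (List.mem_of_getElem? hm) (by assumption)
      | (exfalso; simp_all [rank])
  | muRVar n hp hm =>
    generalize hA : CE.mu _ = A at h'
    cases h' <;> cases hA <;> first
      | exact congrArg CE.var ((List.getElem?_inj (List.getElem?_eq_some_iff.1 hm).1 hM).1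
          (hm.trans (Eq.symm (by assumption))))
      | exact absurd (List.mem_of_getElem? hm) (by assumption)
      | (exfalso; simp_all [rank])
  | insertion c d =>
    generalize hA : CE.insertion c = A at h'
    generalize hB : CE.insertion d = B at h'
    cases h'
    case insertion => cases hA; cases hB; rfl
    case list hins _ _ =>
      cases hA
      cases hB
      exact absurd ⟨rfl, rfl, Option.some_ne_none _, Option.some_ne_none _⟩ hins
    all_goals simp [CE.insertion] at hA hB
  | jump i S S' R h ih =>
    generalize hA : CE.list _ _ _ = A at h'
    generalize hB : CE.list _ _ _ = B at h'
    cases h'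
    case jump j T T' R' h' =>
      obtain rfl : i = j := Finset.singleton_inj.1 (CE.list.inj hA).1
      obtain rfl : S = T := congrFun (eq_of_heq (CE.list.inj hA).2.1) ⟨i, by simp⟩
      obtain rfl : S' = T' := congrFun (eq_of_heq (CE.list.inj hB).2.1) ⟨i, by simp⟩
      rw [ih h' hM]
    case list hjump _ =>
      cases hA
      cases hB
      exact absurd ⟨rfl, Finset.card_singleton i, rfl, rfl⟩ hjump
    all_goals simp [CE.insertion] at hA hB
  | list R hins hjump h ih =>
    generalize hA : CE.list _ _ _ = A at h'
    generalize hB : CE.list _ _ _ = B at h'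
    cases h'
    case insertion =>
      cases hA
      cases hB
      exact absurd ⟨rfl, rfl, Option.some_ne_none _, Option.some_ne_none _⟩ hins
    case jump j T T' R' h' =>
      cases hA
      cases hB
      exact absurd ⟨rfl, Finset.card_singleton j, rfl, rfl⟩ hjump
    case list R' _ _ h' =>
      cases hA
      cases hB
      rw [show R = R' from funext fun i => ih i (h' i) hM]
    all_goals simp at hA hB

end CE

end CES

/-! ### Contexts are determined by their action -/

namespace CES

section

variable {F : Type*} {ar : F → ℕ} {X : Type*} {m : Ctx ar X → Ctx ar X → Ctx ar X}

theorem Term.depth_lt_depth_app (f : F) (ts : Fin (ar f) → Term ar X) (i : Fin (ar f)) :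
    (ts i).depth < (Term.app f ts).depth :=
  depth_lt_of_child? (i := i) (by simp [Term.child?])

theorem Ctx.depth_le_depth_plug (c : Ctx ar X) (t : Term ar X) : t.depth ≤ (c.plug t).depth := by
  induction c with
  | hole => exact le_rfl
  | app f i c ts ih =>
    refine ih.trans (le_of_lt ?_)
    have := Term.depth_lt_depth_app f
      (fun j => if h : j = i then c.plug t else ts ⟨j, h⟩) i
    rwa [dif_pos rfl] at this

/-- The strict inequality separates the bare hole from all other contexts. -/
theorem Ctx.depth_lt_depth_plug_app (f : F) (i : Fin (ar f)) (c : Ctx ar X)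
    (ts : {j : Fin (ar f) // j ≠ i} → Term ar X) (t : Term ar X) :
    t.depth < ((Ctx.app f i c ts).plug t).depth := by
  have := Term.depth_lt_depth_app f (fun j => if h : j = i then c.plug t else ts ⟨j, h⟩) i
  rw [dif_pos rfl] at this
  exact (c.depth_le_depth_plug t).trans_lt this

theorem Ctx.plug_app_apply {f : F} {i : Fin (ar f)} {c : Ctx ar X}
    {ts : {j : Fin (ar f) // j ≠ i} → Term ar X} {t : Term ar X} {us : Fin (ar f) → Term ar X}
    (h : (Ctx.app f i c ts).plug t = .app f us) :
    us i = c.plug t ∧ ∀ j : {j : Fin (ar f) // j ≠ i}, us j = ts j := by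
  rw [Ctx.plug, Term.app.injEq] at h
  have h := eq_of_heq h.2
  subst h
  exact ⟨dif_pos rfl, fun j => dif_neg j.2⟩

theorem Ctx.plug_injective (c : Ctx ar X) : Function.Injective c.plug := by
  induction c with
  | hole => exact fun _ _ h => h
  | app f i c ts ih =>
    intro t t' h
    have := (plug_app_apply (h.trans (by rw [Ctx.plug]))).1
    rw [dif_pos rfl] at this
    exact ih this.symm

/-- A context is determined by the terms that it yields. -/
theorem Ctx.eq_of_plug_eq [Nontrivial X] (c : Ctx ar X) :
    ∀ d : Ctx ar X, (∀ t, c.plug t = d.plug t) → c = d := by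
  obtain ⟨x, y, hxy⟩ := exists_pair_ne X
  induction c with
  | hole =>
    intro d h
    cases d with
    | hole => rfl
    | app f i d ts =>
      exact absurd (congrArg Term.depth (h (.var x))) (depth_lt_depth_plug_app f i d ts _).ne
  | app f i c ts ih =>
    intro d h
    cases d with
    | hole =>
      exact absurd (congrArg Term.depth (h (.var x))) (depth_lt_depth_plug_app f i c ts _).ne'
    | app g j d us =>
      obtain rfl : f = g := (Term.app.inj (h (.var x))).1
      have key := fun t => plug_app_apply ((h t).trans (by rw [Ctx.plug]))
      by_cases hij : i = j
      · subst hij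
        have h1 : c = d := ih d fun t => by
          have := (key t).1
          rw [dif_pos rfl] at this
          exact this.symm
        have h2 : ts = us := funext fun k => by
          have := (key (.var x)).2 k
          rw [dif_neg k.2] at this
          exact this.symm
        rw [h1, h2]
      -- With holes at different children, child `i` varies with the plugged term on one side and is
      -- constant on the other; two distinct variables expose this.
      · have h1 := (key (.var x)).1
        have h2 := (key (.var y)).1
        rw [dif_neg hij] at h1 h2
        exact absurd (c.plug_injective (h1.symm.trans h2)) fun h => hxy (Term.var.inj h)

theorem Ctx.comp_assoc (c d e : Ctx ar X) : (c.comp d).comp e = c.comp (d.comp e) := by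
  induction c with
  | hole => rfl
  | app f i c ts ih => simp only [Ctx.comp, ih]

namespace Plan

theorem merge_assoc (hm : ∀ c d e, m (m c d) e = m c (m d e)) (p q r : Plan ar X) :
    merge m (merge m p q) r = merge m p (merge m q r) := by
  funext l
  simp only [merge]
  cases p l <;> cases q l <;> cases r l <;> simp [hm]

theorem merge_comm (hm : ∀ c d, m c d = m d c) (p q : Plan ar X) :
    merge m p q = merge m q p := by
  funext l
  simp only [merge]
  cases p l <;> cases q l <;> simp
  exact hm _ _

theorem merge_self (hm : ∀ c, m c c = c) (p : Plan ar X) : merge m p p = p := by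
  funext l
  simp only [merge]
  cases p l <;> simp [hm]

end Plan

/-! ### Algebraic laws of the combination -/

namespace CE

theorem unify_spec {S S' : CE ar X} (hS : S.ClosedBelow 0) (hS' : S'.ClosedBelow 0) :
    Unif m [] S S' (unify m S S') := by
  have h : ∃ R, Unif m [] S S' R := exists_unif hS hS'
  rw [unify, dif_pos h]
  exact h.choose_spec

theorem existsUnique_unif {S S' : CE ar X} (hS : S.ClosedBelow 0) (hS' : S'.ClosedBelow 0) :
    ∃! R, Unif m [] S S' R :=
  ⟨_, unify_spec hS hS', fun _ h => h.unique (unify_spec hS hS') List.nodup_nil⟩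

theorem Admissible.comb {S S' : CE ar X} (hS : S.Admissible) (hS' : S'.Admissible) :
    (comb m S S').Admissible :=
  have h := unify_spec (m := m) hS.1 hS'.1
  ⟨⟨h.closedBelow hS.1 hS'.1, hS.1, hS'.1⟩, h.monotone hS hS', hS.2, hS'.2⟩

/-- Combination of strategies is merging of their plans. -/
theorem closedPlan_comb (har : BddAbove (Set.range ar)) {S S' : CE ar X} (hS : S.Admissible)
    (hS' : S'.Admissible) (t : Term ar X) :
    (CE.comb m S S').closedPlan t =
      Option.merge (Plan.merge m) (S.closedPlan t) (S'.closedPlan t) := by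
  have h := (unify_spec (m := m) hS.1 hS'.1).plan_eq har hS hS' (fun _ _ => none)
    (fun n p hp => by simp at hp) t
  rw [← Plan.map₂_or_or, ← h]
  rfl

theorem admissible_insertion (c : Ctx ar X) : (insertion c).Admissible :=
  ⟨fun i => absurd i.2 (Finset.notMem_empty _), fun i => absurd i.2 (Finset.notMem_empty _)⟩

/-- The plan that inserts a context at the root. -/
def rootPlan (c : Ctx ar X) : Plan ar X := Plan.node (some c) fun _ => none

theorem closedPlan_insertion (c : Ctx ar X) (t : Term ar X) :
    (insertion c).closedPlan t = some (rootPlan c) := by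
  simp [closedPlan, insertion, plan, Plan.tryNode, rootPlan]

theorem merge_rootPlan (c d : Ctx ar X) :
    Plan.merge m (rootPlan c) (rootPlan d) = rootPlan (m c d) := by
  simp [rootPlan, Plan.merge_node]

theorem embed_rootPlan (c : Ctx ar X) (t : Term ar X) : t.embed (rootPlan c) = c.plug t := by
  cases t with
  | var x => rfl
  | app f ts =>
    simp only [Term.embed, rootPlan, Plan.node, plugOpt, Option.bind_none, Term.embed_none]

/-- Turns a law for strategies into an equation between contexts; it serves the three converse
directions. -/
theorem eq_of_rootPlan [Nontrivial X] {S S' : CE ar X} {c d : Ctx ar X} (h : S.Equivalent S')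
    (hS : ∀ t, S.closedPlan t = some (rootPlan c))
    (hS' : ∀ t, S'.closedPlan t = some (rootPlan d)) : c = d := by
  refine c.eq_of_plug_eq d fun t => ?_
  have := h t
  rw [eval_eq_map_closedPlan, eval_eq_map_closedPlan, hS, hS'] at this
  simpa [embed_rootPlan] using this

/-- Only this direction holds in general: inserting `hole` at a child as well can change the plan
but not the result. -/
theorem equivalent_of_closedPlan_eq {S S' : CE ar X} (h : ∀ t, S.closedPlan t = S'.closedPlan t) :
    S.Equivalent S' := fun t => by
  rw [eval_eq_map_closedPlan, eval_eq_map_closedPlan, h]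

/-- Failure, unlike plans in general, is visible in `eval`; so neutrality extends to every strategy
equivalent to `fail`. -/
theorem closedPlan_eq_none_of_equivalent_fail {S : CE ar X} (h : S.Equivalent .fail)
    (t : Term ar X) : S.closedPlan t = none := by
  have := h t
  rw [eval_eq_map_closedPlan] at this
  exact Option.map_eq_none_iff.1 this

theorem comb_assoc (har : BddAbove (Set.range ar)) (hm : ∀ c d e, m (m c d) e = m c (m d e))
    {S₁ S₂ S₃ : CE ar X} (h₁ : S₁.Admissible) (h₂ : S₂.Admissible) (h₃ : S₃.Admissible) :
    (comb m (comb m S₁ S₂) S₃).Equivalent (comb m S₁ (comb m S₂ S₃)) := by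
  refine equivalent_of_closedPlan_eq fun t => ?_
  rw [closedPlan_comb har (h₁.comb h₂) h₃, closedPlan_comb har h₁ h₂,
    closedPlan_comb har h₁ (h₂.comb h₃), closedPlan_comb har h₂ h₃]
  cases S₁.closedPlan t <;> cases S₂.closedPlan t <;> cases S₃.closedPlan t <;>
    simp [Plan.merge_assoc hm]

theorem comb_comm (har : BddAbove (Set.range ar)) (hm : ∀ c d, m c d = m d c)
    {S S' : CE ar X} (h : S.Admissible) (h' : S'.Admissible) :
    (comb m S S').Equivalent (comb m S' S) := by
  refine equivalent_of_closedPlan_eq fun t => ?_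
  rw [closedPlan_comb har h h', closedPlan_comb har h' h]
  cases S.closedPlan t <;> cases S'.closedPlan t <;> simp
  exact Plan.merge_comm hm _ _

theorem comb_self (har : BddAbove (Set.range ar)) (hm : ∀ c, m c c = c)
    {S : CE ar X} (h : S.Admissible) : (comb m S S).Equivalent S := by
  refine equivalent_of_closedPlan_eq fun t => ?_
  rw [closedPlan_comb har h h]
  cases S.closedPlan t <;> simp [Plan.merge_self hm]

theorem closedPlan_comb_of_rootPlan (har : BddAbove (Set.range ar)) {S S' : CE ar X}
    (h : S.Admissible) (h' : S'.Admissible) {c d : Ctx ar X} {t : Term ar X}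
    (hS : S.closedPlan t = some (rootPlan c)) (hS' : S'.closedPlan t = some (rootPlan d)) :
    (comb m S S').closedPlan t = some (rootPlan (m c d)) := by
  rw [closedPlan_comb har h h', hS, hS', Option.merge_some_some, merge_rootPlan]

end CE

end

end CES

/-! ### The main theorem -/

theorem mainTheorem4 {F : Type*} (ar : F → ℕ) (har : BddAbove (Set.range ar))
    {X : Type*} [Infinite X] :
    (∀ m : CES.Ctx ar X → CES.Ctx ar X → CES.Ctx ar X,
      -- combination is a well-defined operation on closed monotone strategies
      (∀ S S' : CES.CE ar X, S.Admissible → S'.Admissible →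
        (∃! R, CES.CE.Unif m [] S S' R) ∧ (CES.CE.comb m S S').Admissible) ∧
      -- neutral element
      (∀ e S : CES.CE ar X, e.Admissible → S.Admissible → e.Equivalent .fail →
        (CES.CE.comb m e S).Equivalent S ∧ (CES.CE.comb m S e).Equivalent S) ∧
      -- associativity
      ((∀ S₁ S₂ S₃ : CES.CE ar X, S₁.Admissible → S₂.Admissible → S₃.Admissible →
          (CES.CE.comb m (CES.CE.comb m S₁ S₂) S₃).Equivalent
            (CES.CE.comb m S₁ (CES.CE.comb m S₂ S₃))) ↔
        ∀ c d e : CES.Ctx ar X, m (m c d) e = m c (m d e)) ∧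
      -- commutativity
      ((∀ S S' : CES.CE ar X, S.Admissible → S'.Admissible →
          (CES.CE.comb m S S').Equivalent (CES.CE.comb m S' S)) ↔
        ∀ c d : CES.Ctx ar X, m c d = m d c) ∧
      -- idempotency
      ((∀ S : CES.CE ar X, S.Admissible → (CES.CE.comb m S S).Equivalent S) ↔
        ∀ c : CES.Ctx ar X, m c c = c)) ∧
    -- associativity for the standard merging `c · d = c[d]`
    (∀ S₁ S₂ S₃ : CES.CE ar X, S₁.Admissible → S₂.Admissible → S₃.Admissible →
      (CES.CE.comb CES.Ctx.comp (CES.CE.comb CES.Ctx.comp S₁ S₂) S₃).Equivalent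
        (CES.CE.comb CES.Ctx.comp S₁ (CES.CE.comb CES.Ctx.comp S₂ S₃))) := by
  refine ⟨fun m => ⟨fun S S' hS hS' => ⟨CES.CE.existsUnique_unif hS.1 hS'.1, hS.comb hS'⟩,
    fun e S he hS hfail => ?_, ⟨fun h c d e => ?_, fun hm S₁ S₂ S₃ h₁ h₂ h₃ =>
      CES.CE.comb_assoc har hm h₁ h₂ h₃⟩, ⟨fun h c d => ?_, fun hm S S' hS hS' =>
      CES.CE.comb_comm har hm hS hS'⟩, ⟨fun h c => ?_, fun hm S hS =>
      CES.CE.comb_self har hm hS⟩⟩, fun S₁ S₂ S₃ h₁ h₂ h₃ =>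
      CES.CE.comb_assoc har CES.Ctx.comp_assoc h₁ h₂ h₃⟩
  · have hnone := CES.CE.closedPlan_eq_none_of_equivalent_fail hfail
    constructor
    · refine CES.CE.equivalent_of_closedPlan_eq fun t => ?_
      rw [CES.CE.closedPlan_comb har he hS, hnone, Option.merge_none_left]
    · refine CES.CE.equivalent_of_closedPlan_eq fun t => ?_
      rw [CES.CE.closedPlan_comb har hS he, hnone, Option.merge_none_right]
  -- For the converses the law is tested on root insertions, whose combinations have root plans
  -- built by `m` on every term.
  · have hc := CES.CE.admissible_insertion c
    have hd := CES.CE.admissible_insertion d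
    have he := CES.CE.admissible_insertion e
    refine CES.CE.eq_of_rootPlan (h _ _ _ hc hd he) (fun t => ?_) (fun t => ?_)
    · exact CES.CE.closedPlan_comb_of_rootPlan har (hc.comb hd) he
        (CES.CE.closedPlan_comb_of_rootPlan har hc hd (CES.CE.closedPlan_insertion c t)
          (CES.CE.closedPlan_insertion d t)) (CES.CE.closedPlan_insertion e t)
    · exact CES.CE.closedPlan_comb_of_rootPlan har hc (hd.comb he)
        (CES.CE.closedPlan_insertion c t) (CES.CE.closedPlan_comb_of_rootPlan har hd he
          (CES.CE.closedPlan_insertion d t) (CES.CE.closedPlan_insertion e t))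
  · have hc := CES.CE.admissible_insertion c
    have hd := CES.CE.admissible_insertion d
    exact CES.CE.eq_of_rootPlan (h _ _ hc hd)
      (fun t => CES.CE.closedPlan_comb_of_rootPlan har hc hd
        (CES.CE.closedPlan_insertion c t) (CES.CE.closedPlan_insertion d t))
      (fun t => CES.CE.closedPlan_comb_of_rootPlan har hd hc
        (CES.CE.closedPlan_insertion d t) (CES.CE.closedPlan_insertion c t))
  · have hc := CES.CE.admissible_insertion c
    exact CES.CE.eq_of_rootPlan (h _ hc)
      (fun t => CES.CE.closedPlan_comb_of_rootPlan har hc hc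
        (CES.CE.closedPlan_insertion c t) (CES.CE.closedPlan_insertion c t))
      (fun t => CES.CE.closedPlan_insertion c t)
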